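/- Identify the plane with $\mathbb{C}$. Let $P,P'\subset\mathbb{C}$ be simple polygons (closed topological disks bounded by closed polygonal lines) with vertex sets $\mathcal V_P,\mathcal V_{P'}$, and let $I=\{1,\dots,m\}$. Let $\mathcal S=\{S_1,\dots,S_m\}$ and $\mathcal S'=\{S'_1,\dots,S'_m\}$ be systems of contracting similarities $z\mapsto q e^{i\alpha}(z-c)+c$ with $0<q<1$; write $P_k=S_k(P)$, $\mathcal V_{P_k}=S_k(\mathcal V_P)$ (and $P'_k$, $\mathcal V_{P'_k}$ for $\mathcal S'$, $P'$) and $S_{\mathbf i}=S_{i_1}\circ\cdots\circ S_{i_k}$ for a non-empty multiindex $\mathbf i=i_1\dots i_k$. A system $\mathcal S$ is a *generalized $P$-polygonal system* if (D2) $P_i\cap P_j=\mathcal V_{P_i}\cap\mathcal V_{P_j}$ and $\#(\mathcal V_{P_i}\cap\mathcal V_{P_j})<2$ for all $i\ne j$; (D3) $\mathcal V_P\subset\bigcup_k\mathcal V_{P_k}$; (D4) $\bigcup_kP_k$ is contractible. It is a *contractible $P$-polygonal system* if moreover (D1) $P_k\subset P$ for all $k$. For $\delta>0$, a generalized $P'$-polygonal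 system $\mathcal S'$ is a *$\delta$-deformation* of $\mathcal S$ if there is a bijection $f:\bigcup_k\mathcal V_{P_k}\to\bigcup_k\mathcal V_{P'_k}$ such that $f|_{\mathcal V_P}$ extends to a homeomorphism $P\to P'$, $|f(x)-x|<\delta$ for all $x\in\bigcup_k\mathcal V_{P_k}$, and $f(S_k(x))=S'_k(f(x))$ for all $k\in I$, $x\in\mathcal V_P$. The attractor $K'$ of $\mathcal S'$ is the non-empty compact set with $K'=\bigcup_kS'_k(K')$; a dendrite is a locally connected continuum containing no simple closed curve. A vertex $A\in\mathcal V_{P'}$ is *cyclic* if $S'_{\mathbf i}(A)=A$ for some non-empty multiindex $\mathbf i$. A *parameter* of a cyclic vertex $A$ is a number $\lambda=\alpha/\ln r$ where, for some non-empty multiindex $\mathbf i$, $S'_{\mathbf i}(z)=re^{i\alpha}(z-A)+A$, $r>0$, and the value $\alpha$ of the rotation angle (a priori defined only modulo $2\pi$) is the total increment of a continuous argument of $z-A$ along some path in $K'\setminus\{A\}$ leading from some point $x$ to its image $S'_{\mathbf i}(x)$. **Theorem.** Let the generalized $P'$-polygonal system $\mathcal S'$ be a $\delta$-deformation, for some $\delta>0$,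 of a contractible $P$-polygonal system $\mathcal S$, and let the attractor $K'$ of $\mathcal S'$ be a dendrite. Then $\mathcal S'$ satisfies the parameter matching condition: every cyclic vertex $A\in\mathcal V_{P'}$ has exactly one parameter $\lambda_A$, and if $B\in\bigcup_k\mathcal V_{P'_k}$, $A,A'$ are cyclic vertices, and $S'_{\mathbf i}(A)=S'_{\mathbf j}(A')=B$ for some non-empty multiindices $\mathbf i,\mathbf j$, then $\lambda_A=\lambda_{A'}$. -/

import Mathlib

noncomputable section

namespace PolygonalSystem

/-! ### Polygons in the plane `ℂ` -/

/-- The vertex set of a polygon. -/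
def vertexSet {n : ℕ} (P : Polygon ℂ n) : Set ℂ := Set.range P.vertices

/-- The closed polygonal line is a simple closed curve: at least three vertices, pairwise
distinct, and two different edges meet only in their common endpoints. -/
def IsSimple {n : ℕ} (P : Polygon ℂ n) : Prop :=
  3 ≤ n ∧ Function.Injective P.vertices ∧
    ∀ i j : Fin n, i ≠ j →
      P.edgeSet ℝ i ∩ P.edgeSet ℝ j =
        {P.vertices i, P.vertices (finRotate n i)} ∩ {P.vertices j, P.vertices (finRotate n j)}

/-- The polygon as a subset of the plane: its boundary together with all points lying in a
bounded component of the complement of the boundary. For a simple polygon this is a closed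
topological disk. -/
def region {n : ℕ} (P : Polygon ℂ n) : Set ℂ :=
  P.boundary ℝ ∪
    {z | z ∉ P.boundary ℝ ∧ Bornology.IsBounded (connectedComponentIn (P.boundary ℝ)ᶜ z)}

/-! ### Contracting similarities and systems -/

/-- A contracting (orientation preserving) similarity `z ↦ a (z - c) + c` of the plane, where
`a = q e ^ (i α)` and `0 < q < 1`. -/
structure ContractingSimilarity where
  /-- the multiplier `q e ^ (i α)` -/
  mult : ℂ
  /-- the fixed point -/
  fix : ℂ
  mult_ne_zero : mult ≠ 0
  norm_mult_lt_one : ‖mult‖ < 1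

/-- The map `z ↦ a (z - c) + c`. -/
def ContractingSimilarity.toFun (s : ContractingSimilarity) (z : ℂ) : ℂ :=
  s.mult * (z - s.fix) + s.fix

instance : CoeFun ContractingSimilarity (fun _ => ℂ → ℂ) := ⟨ContractingSimilarity.toFun⟩

/-- The composition `S_{j₁} ∘ S_{j₂} ∘ ⋯ ∘ S_{jₙ}` along a multiindex `j₁ j₂ … jₙ`. -/
def wordMap {m : ℕ} (S : Fin m → ContractingSimilarity) : List (Fin m) → ℂ → ℂ
  | [], z => z
  | k :: w, z => S k (wordMap S w z)

/-- The vertices of the polygon `P_k = S_k(P)`. -/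
def pieceVertices {n m : ℕ} (P : Polygon ℂ n) (S : Fin m → ContractingSimilarity)
    (k : Fin m) : Set ℂ := S k '' vertexSet P

/-- The polygon `P_k = S_k(P)`. -/
def piece {n m : ℕ} (P : Polygon ℂ n) (S : Fin m → ContractingSimilarity)
    (k : Fin m) : Set ℂ := S k '' region P

/-- A generalized `P`-polygonal system of similarities. -/
structure IsGeneralizedPolygonalSystem {n m : ℕ} (P : Polygon ℂ n)
    (S : Fin m → ContractingSimilarity) : Prop where
  simple : IsSimple P
  inter_eq : ∀ i j, i ≠ j →
    piece P S i ∩ piece P S j = pieceVertices P S i ∩ pieceVertices P S j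
  inter_card : ∀ i j, i ≠ j → (pieceVertices P S i ∩ pieceVertices P S j).encard < 2
  vertices_subset : vertexSet P ⊆ ⋃ k, pieceVertices P S k
  contractible : ContractibleSpace (⋃ k, piece P S k : Set ℂ)

/-- A contractible `P`-polygonal system of similarities. -/
structure IsContractiblePolygonalSystem {n m : ℕ} (P : Polygon ℂ n)
    (S : Fin m → ContractingSimilarity) : Prop
    extends IsGeneralizedPolygonalSystem P S where
  piece_subset : ∀ k, piece P S k ⊆ region P

/-- The system `S'` (with polygon `P'`) is a `δ`-deformation of the system `S` (with
polygon `P`). -/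
def IsDeformation {n n' m : ℕ} (δ : ℝ) (P : Polygon ℂ n) (S : Fin m → ContractingSimilarity)
    (P' : Polygon ℂ n') (S' : Fin m → ContractingSimilarity) : Prop :=
  ∃ f : ℂ → ℂ,
    Set.BijOn f (⋃ k, pieceVertices P S k) (⋃ k, pieceVertices P' S' k) ∧
    (∃ g : region P ≃ₜ region P', ∀ x : region P, (x : ℂ) ∈ vertexSet P → (g x : ℂ) = f x) ∧
    (∀ x ∈ ⋃ k, pieceVertices P S k, ‖f x - x‖ < δ) ∧
    (∀ k, ∀ x ∈ vertexSet P, f (S k x) = S' k (f x))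

/-! ### Attractors and dendrites -/

/-- `K` is the attractor of the system `S`. -/
def IsAttractor {m : ℕ} (S : Fin m → ContractingSimilarity) (K : Set ℂ) : Prop :=
  K.Nonempty ∧ IsCompact K ∧ K = ⋃ k, S k '' K

/-- A dendrite: a locally connected continuum containing no simple closed curve. -/
def IsDendrite (K : Set ℂ) : Prop :=
  IsCompact K ∧ IsConnected K ∧ LocallyConnectedSpace K ∧
    ¬ ∃ c : Circle → ℂ, Continuous c ∧ Function.Injective c ∧ Set.range c ⊆ K

/-! ### Cyclic vertices and their parameters -/

/-- A cyclic vertex: a vertex of `P` fixed by `S_w` for some (non-empty) multiindex `w`. -/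
def IsCyclicVertex {n m : ℕ} (P : Polygon ℂ n) (S : Fin m → ContractingSimilarity)
    (A : ℂ) : Prop :=
  A ∈ vertexSet P ∧ ∃ w : List (Fin m), w ≠ [] ∧ wordMap S w A = A

/-- `α` is the angle through which `z - A` turns along some path in `K \ {A}` from a point `x`
to the point `y`: along the path `γ` one has `γ t - A = |γ t - A| e ^ (i θ t)` with a continuous
argument `θ` whose total increment is `α`. -/
def IsTurningAngle (K : Set ℂ) (A x y : ℂ) (α : ℝ) : Prop :=
  ∃ (γ : ℝ → ℂ) (θ : ℝ → ℝ),
    ContinuousOn γ (Set.Icc 0 1) ∧ ContinuousOn θ (Set.Icc 0 1) ∧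
    (∀ t ∈ Set.Icc (0 : ℝ) 1, γ t ∈ K \ {A}) ∧
    (∀ t ∈ Set.Icc (0 : ℝ) 1, γ t - A = ‖γ t - A‖ * Complex.exp (θ t * Complex.I)) ∧
    γ 0 = x ∧ γ 1 = y ∧ θ 1 - θ 0 = α

/-- `lam = α / ln r` is a parameter of the cyclic vertex `A` of the system `S` with attractor
`K`. Here `S_w(z) = r e ^ (i α) (z - A) + A` for some multiindex `w`, and among all the values of
the rotation angle of `S_w`, which differ by multiples of `2π`, the value `α` is the one given by
the geometry of the system: it is the angle through which a path in `K \ {A}` from a point `x` to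
its image `S_w(x)` turns around `A`. -/
def IsParameter {m : ℕ} (S : Fin m → ContractingSimilarity) (K : Set ℂ) (A : ℂ)
    (lam : ℝ) : Prop :=
  ∃ (w : List (Fin m)) (r α : ℝ), w ≠ [] ∧ 0 < r ∧
    (∀ z, wordMap S w z = r * Complex.exp (α * Complex.I) * (z - A) + A) ∧
    (∃ x, IsTurningAngle K A x (wordMap S w x) α) ∧
    lam = α / Real.log r

/-- The parameter matching condition for the system `S` with attractor `K`: every cyclic vertex
`A` has a well-defined parameter `λ_A`, and `λ_A = λ_{A'}` whenever `S_i(A) = S_j(A') = B` for a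
vertex `B` of one of the polygons `P_k` and some multiindices `i`, `j`. -/
def ParameterMatchingCondition {n m : ℕ} (P : Polygon ℂ n)
    (S : Fin m → ContractingSimilarity) (K : Set ℂ) : Prop :=
  (∀ A, IsCyclicVertex P S A → ∃! lam : ℝ, IsParameter S K A lam) ∧
  ∀ B ∈ ⋃ k, pieceVertices P S k, ∀ A A' : ℂ, IsCyclicVertex P S A → IsCyclicVertex P S A' →
    ∀ i j : List (Fin m), i ≠ [] → j ≠ [] → wordMap S i A = B → wordMap S j A' = B →
      ∀ lam lam' : ℝ, IsParameter S K A lam → IsParameter S K A' lam' → lam = lam'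

end PolygonalSystem

end

namespace PolygonalSystem

open Set Metric

/-! In the coordinate `z = A + exp ζ`, a similarity fixing `A` is the translation by `v = log r +
iα`. A path in `K' \ {A}` from `x` to the image of `x`, repeated under this translation, gives a
curve in `K'` whose logarithm stays at bounded distance from a half-line of direction `v`; the
parameter is the slope `im v / re v`. A map `S_u` carries this spiral to one around `S_u(A)` with
the same `v`, so uniqueness of the parameter and matching over `B` are one assertion: two spirals of
`K'` at the same point have equal slopes (`HasSpiral.slope_eq`). If the slopes differed, a planar
fixed point argument (`exists_crossing`) would make the first logarithmic curve meet the second one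
shifted by `2πij`, for two consecutive integers `j`. The arcs between these meetings form a closed
path in `K'` of winding number `±1`, and such a path contains a simple closed curve
(`exists_circle_of_winding`), which a dendrite excludes.

For existence it suffices to join two points of one orbit of `T = S_w` by a path in `K' \ {A}`
(`IsAttractor.exists_joinedIn_iterate`). Otherwise the points `T^n x` lie in different path
components of `K' \ {A}`, and the images of one path from `x` to `A` form a triod in `K'`. A triod
meets every small perturbation of itself (`triod_inter_perturbation`), so similar copies of `K'`
with nearly equal sizes, directions and positions must intersect. Yet every one of these components
contains a copy of `K'`, all of comparable size and at comparable distance from `A`; by pigeonhole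
two of these disjoint copies are nearly equal, a contradiction. The paths come from self-similarity:
a connected attractor is path connected (`IsAttractor.joinedIn`). -/

/-! ### Continuous logarithms -/

/-- A nowhere vanishing continuous function on a simply connected, locally path connected space
has a continuous logarithm, with any prescribed admissible value at one point. -/
theorem exists_continuous_log {X : Type*} [TopologicalSpace X] [SimplyConnectedSpace X]
    [LocallyPathConnectedSpace X] {g : X → ℂ} (hg : Continuous g) (h0 : ∀ x, g x ≠ 0)
    (x₀ : X) (e₀ : ℂ) (he : Complex.exp e₀ = g x₀) :
    ∃ f : X → ℂ, Continuous f ∧ f x₀ = e₀ ∧ ∀ x, Complex.exp (f x) = g x := by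
  obtain ⟨f, ⟨h1, h2⟩, -⟩ := Complex.isCoveringMapOn_exp.existsUnique_continuousMap_lifts
    (⟨g, hg⟩ : C(X, ℂ)) (a₀ := x₀) (e₀ := e₀) he (fun x => h0 x)
  exact ⟨f, f.continuous, h1, fun x => congrFun h2 x⟩

/-- Two continuous logarithms of the same function which agree at one point agree everywhere. -/
theorem log_unique {X : Type*} [TopologicalSpace X] [PreconnectedSpace X] {f g : X → ℂ}
    (hf : Continuous f) (hg : Continuous g) (h : ∀ x, Complex.exp (f x) = Complex.exp (g x))
    (x₀ : X) (h₀ : f x₀ = g x₀) : f = g :=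
  Complex.isCoveringMap_exp.eq_of_comp_eq hf hg
    (funext fun x => Subtype.ext (h x)) x₀ h₀

/-- A bounded continuous self-map of the plane has a fixed point. -/
theorem exists_fixedPoint_of_bounded {b : ℂ → ℂ} (hb : Continuous b) {R : ℝ}
    (hR : ∀ z, ‖b z‖ ≤ R) : ∃ z, b z = z := by
  by_contra! hne
  have hR0 : 0 ≤ R := (norm_nonneg _).trans (hR 0)
  have hne' : ∀ z, z - b z ≠ 0 := fun z => sub_ne_zero.2 (hne z).symm
  obtain ⟨L, hLc, -, hL⟩ := exists_continuous_log (g := fun z => z - b z) (by fun_prop) hne' 0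
    (Complex.log (0 - b 0)) (Complex.exp_log (hne' 0))
  set c : ℝ → ℂ := fun θ => ((R + 1 : ℝ) : ℂ) * Complex.exp (θ * Complex.I) with hc
  have hcn : ∀ θ, ‖c θ‖ = R + 1 := fun θ => by
    simp only [hc, norm_mul, Complex.norm_exp_ofReal_mul_I, Complex.norm_real, mul_one,
      Real.norm_eq_abs]
    exact abs_of_pos (by linarith)
  have hc0 : ∀ θ, c θ ≠ 0 := fun θ h => by
    have := hcn θ; rw [h, norm_zero] at this; linarith
  have hcc : Continuous c := by fun_prop
  have hsl : ∀ θ, 1 - b (c θ) / c θ ∈ Complex.slitPlane := fun θ => by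
    apply Complex.ball_one_subset_slitPlane
    rw [mem_ball_iff_norm, sub_sub_cancel_left, norm_neg, norm_div, hcn]
    rw [div_lt_one (by linarith)]
    linarith [hR (c θ)]
  -- On the circle of radius `R + 1` one has `z - b z = z (1 - b z / z)`, where the second factor
  -- has a principal logarithm. Subtracting it leaves a logarithm of `z` along the circle, which is
  -- periodic and yet must grow by `2πi`.
  set l : ℝ → ℂ := fun θ => L (c θ) - Complex.log (1 - b (c θ) / c θ) with hl
  have hlc : Continuous l := by
    apply (hLc.comp hcc).sub
    rw [continuous_iff_continuousAt]
    intro θ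
    exact ContinuousAt.clog (by
      have := (continuous_const.sub ((hb.comp hcc).div hcc hc0) : Continuous
        fun θ => (1 : ℂ) - b (c θ) / c θ)
      exact this.continuousAt) (hsl θ)
  have hle : ∀ θ, Complex.exp (l θ) = c θ := fun θ => by
    simp only [hl]
    rw [Complex.exp_sub, hL, Complex.exp_log (Complex.slitPlane_ne_zero (hsl θ))]
    have h1 := hne' (c θ)
    have h2 := hc0 θ
    rw [one_sub_div h2]
    field_simp
  have key : l = fun θ : ℝ => θ * Complex.I + l 0 := by
    refine log_unique hlc (by fun_prop) (fun θ => ?_) 0 (by simp)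
    rw [Complex.exp_add, hle, hle]
    simp [hc, mul_comm]
  have h2 : l (2 * Real.pi) = l 0 := by
    have : c (2 * Real.pi) = c 0 := by simp [hc]
    simp only [hl, this]
  have h3 := congrFun key (2 * Real.pi)
  rw [h2] at h3
  simp at h3

/-! ### Arcs inside paths -/

/-- `C` is what remains of `[a, b]` after the removal of disjoint open intervals, each of which
has the same value of `f` at its two ends. -/
structure IsLoopErased {X : Type*} (f : ℝ → X) (a b : ℝ) (C : Set ℝ) : Prop where
  closed : IsClosed C
  subset : C ⊆ Icc a b
  left_mem : a ∈ C
  right_mem : b ∈ C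
  gap : ∀ s ∈ C, ∀ t ∈ C, s < t → C ∩ Ioo s t = ∅ → f s = f t

theorem isLoopErased_Icc {X : Type*} (f : ℝ → X) {a b : ℝ} (hab : a ≤ b) :
    IsLoopErased f a b (Icc a b) where
  closed := isClosed_Icc
  subset := subset_rfl
  left_mem := left_mem_Icc.2 hab
  right_mem := right_mem_Icc.2 hab
  gap s hs t ht hst h := by
    exfalso
    have : (s + t) / 2 ∈ Icc a b ∩ Ioo s t :=
      ⟨⟨by linarith [hs.1], by linarith [ht.2]⟩, by linarith, by linarith⟩
    rw [h] at this
    exact this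

/-- A gap of the intersection need not be a gap of any member of the chain, but by compactness some
member has a gap whose ends are arbitrarily close to the given ones; continuity of `f` then gives
equality in the limit. -/
theorem isLoopErased_sInter {X : Type*} [MetricSpace X] {f : ℝ → X} {a b : ℝ}
    (hf : ContinuousOn f (Icc a b)) {c : Set (Set ℝ)} (hc : ∀ C ∈ c, IsLoopErased f a b C)
    (hchain : IsChain (· ⊆ ·) c) (hne : c.Nonempty) : IsLoopErased f a b (⋂₀ c) where
  closed := isClosed_sInter fun C hC => (hc C hC).closed
  subset := by
    obtain ⟨C, hC⟩ := hne
    exact (sInter_subset_of_mem hC).trans (hc C hC).subset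
  left_mem := fun C hC => (hc C hC).left_mem
  right_mem := fun C hC => (hc C hC).right_mem
  gap s hs t ht hst h := by
    obtain ⟨C₀, hC₀⟩ := hne
    have hsI := (hc _ hC₀).subset (hs _ hC₀)
    have htI := (hc _ hC₀).subset (ht _ hC₀)
    refine eq_of_forall_dist_le fun ε hε => ?_
    obtain ⟨δ₁, hδ₁, h1⟩ := Metric.continuousOn_iff.1 hf s hsI (ε / 2) (by positivity)
    obtain ⟨δ₂, hδ₂, h2⟩ := Metric.continuousOn_iff.1 hf t htI (ε / 2) (by positivity)
    obtain ⟨η, hη, hη1, hη2, hη3⟩ : ∃ η > 0, η < δ₁ ∧ η < δ₂ ∧ η < (t - s) / 2 := by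
      obtain ⟨η, h, h'⟩ := exists_between (show 0 < min (min δ₁ δ₂) ((t - s) / 2) by
        have : 0 < (t - s) / 2 := by linarith
        positivity)
      simp only [lt_min_iff] at h'
      exact ⟨η, h, h'.1.1, h'.1.2, h'.2⟩
    have : Nonempty c := ⟨⟨C₀, hC₀⟩⟩
    -- The compact middle part of the gap is already missed by one member `C`. The nearest points of
    -- `C` on either side of it, `s'` and `t'` below, bound a gap of `C`.
    obtain ⟨⟨C, hC⟩, hCe⟩ := (isCompact_Icc (a := s + η) (b := t - η)).elim_directed_family_closed
      (fun C : c => (C : Set ℝ)) (fun C => (hc _ C.2).closed)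
      (by
        rw [← sInter_eq_iInter, eq_empty_iff_forall_notMem]
        rintro x ⟨hx1, hx2⟩
        have : x ∈ ⋂₀ c ∩ Ioo s t := ⟨hx2, by linarith [hx1.1], by linarith [hx1.2]⟩
        rw [h] at this
        exact this)
      (fun A B => (hchain.total A.2 B.2).elim (fun h => ⟨A, subset_rfl, h⟩)
        fun h => ⟨B, h, subset_rfl⟩)
    have hcl := (hc C hC).closed
    have hsub := (hc C hC).subset
    have hsC := hs C hC
    have htC := ht C hC
    have hk1 : IsCompact (C ∩ Icc s (s + η)) := isCompact_Icc.inter_left hcl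
    have hk2 : IsCompact (C ∩ Icc (t - η) t) := isCompact_Icc.inter_left hcl
    obtain ⟨s', hs', hs'm⟩ := hk1.exists_isGreatest ⟨s, hsC, by constructor <;> linarith⟩
    obtain ⟨t', ht', ht'm⟩ := hk2.exists_isLeast ⟨t, htC, by constructor <;> linarith⟩
    have heq : f s' = f t' := by
      refine (hc C hC).gap s' hs'.1 t' ht'.1 (by linarith [hs'.2.2, ht'.2.1]) ?_
      rw [eq_empty_iff_forall_notMem]
      rintro x ⟨hx, hx1, hx2⟩
      by_cases h3 : x < s + η
      · exact absurd (hs'm ⟨hx, by linarith [hs'.2.1], h3.le⟩) (not_le.2 hx1)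
      by_cases h4 : t - η < x
      · exact absurd (ht'm ⟨hx, h4.le, by linarith [ht'.2.2]⟩) (not_le.2 hx2)
      have : x ∈ Icc (s + η) (t - η) ∩ C := ⟨⟨not_lt.1 h3, not_lt.1 h4⟩, hx⟩
      rw [hCe] at this
      exact this
    have e1 := h1 s' (hsub hs'.1) (by
      rw [Real.dist_eq, abs_lt]; constructor <;> linarith [hs'.2.1, hs'.2.2])
    have e2 := h2 t' (hsub ht'.1) (by
      rw [Real.dist_eq, abs_lt]; constructor <;> linarith [ht'.2.1, ht'.2.2])
    calc dist (f s) (f t) ≤ dist (f s) (f s') + dist (f s') (f t) := dist_triangle _ _ _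
      _ ≤ ε / 2 + ε / 2 := by
        rw [dist_comm (f s)]
        exact add_le_add e1.le (heq ▸ e2.le)
      _ = ε := by ring

/-- The points `s` and `t` survive, so a gap of the smaller set is either a gap of `C` or the
interval from `s` to `t` itself. -/
theorem IsLoopErased.diff_Ioo {X : Type*} {f : ℝ → X} {a b : ℝ} {C : Set ℝ}
    (hC : IsLoopErased f a b C) {s t : ℝ} (hs : s ∈ C) (ht : t ∈ C) (h : f s = f t) :
    IsLoopErased f a b (C \ Ioo s t) where
  closed := hC.closed.sdiff isOpen_Ioo
  subset := sdiff_subset.trans hC.subset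
  left_mem := ⟨hC.left_mem, fun h => absurd (hC.subset hs).1 (not_le.2 h.1)⟩
  right_mem := ⟨hC.right_mem, fun h => absurd (hC.subset ht).2 (not_le.2 h.2)⟩
  gap u hu v hv huv hg := by
    rw [eq_empty_iff_forall_notMem] at hg
    by_cases h1 : v ≤ s ∨ t ≤ u ∨ t ≤ s
    · refine hC.gap u hu.1 v hv.1 huv (eq_empty_iff_forall_notMem.2 fun x hx => ?_)
      refine hg x ⟨⟨hx.1, fun h2 => ?_⟩, hx.2⟩
      rcases h1 with h1 | h1 | h1
      · linarith [hx.2.2, h2.1]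
      · linarith [hx.2.1, h2.2]
      · linarith [h2.1, h2.2]
    · push Not at h1
      obtain ⟨h1, h2, h3⟩ := h1
      have hus : u ≤ s := by
        by_contra hlt
        exact hu.2 ⟨not_le.1 hlt, h2⟩
      have htv : t ≤ v := by
        by_contra hlt
        exact hv.2 ⟨h1, not_le.1 hlt⟩
      have hus' : u = s := by
        by_contra hne
        exact hg s ⟨⟨hs, fun h => lt_irrefl _ h.1⟩, lt_of_le_of_ne hus hne, h1⟩
      have htv' : t = v := by
        by_contra hne
        exact hg t ⟨⟨ht, fun h => lt_irrefl _ h.2⟩, h2, lt_of_le_of_ne htv hne⟩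
      rw [hus', ← htv', h]

/-- A minimal loop-erased set exists by Zorn's lemma; two of its points with equal values and a
further point between them would allow one more loop to be cut out. -/
theorem exists_loopErased {X : Type*} [MetricSpace X] {f : ℝ → X} {a b : ℝ} (hab : a ≤ b)
    (hf : ContinuousOn f (Icc a b)) : ∃ C, IsLoopErased f a b C ∧
      ∀ s ∈ C, ∀ t ∈ C, s < t → f s = f t → C ∩ Ioo s t = ∅ := by
  obtain ⟨C, -, hC⟩ := zorn_superset_nonempty {C | IsLoopErased f a b C}
    (fun c hc hch hne => ⟨⋂₀ c, isLoopErased_sInter hf hc hch hne, fun s hs => sInter_subset_of_mem hs⟩)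
    (Icc a b) (isLoopErased_Icc f hab)
  refine ⟨C, hC.1, fun s hs t ht _ h => ?_⟩
  have h1 := hC.2 (IsLoopErased.diff_Ioo hC.1 hs ht h) sdiff_subset
  rw [eq_empty_iff_forall_notMem]
  rintro x ⟨hx, hx'⟩
  exact (h1 hx).2 hx'

/-- A strictly monotone size function on nonempty compact sets of a separable metric space:
it decreases as the set grows. -/
noncomputable def coSize {X : Type*} [MetricSpace X] (x : ℕ → X) (E : Set X) : ℝ :=
  ∑' n, (1 / 2 : ℝ) ^ n * min 1 (infDist (x n) E)

section coSize

variable {X : Type*} [MetricSpace X] {x : ℕ → X} {E F : Set X}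

theorem summable_coSize (x : ℕ → X) (E : Set X) :
    Summable fun n => (1 / 2 : ℝ) ^ n * min 1 (infDist (x n) E) := by
  refine Summable.of_nonneg_of_le (fun n => by have := infDist_nonneg (x := x n) (s := E); positivity)
    (fun n => ?_) summable_geometric_two
  exact mul_le_of_le_one_right (by positivity) (min_le_left _ _)

theorem coSize_anti (hE : E.Nonempty) (h : E ⊆ F) : coSize x F ≤ coSize x E := by
  refine Summable.tsum_le_tsum (fun n => ?_) (summable_coSize x F) (summable_coSize x E)
  have := infDist_le_infDist_of_subset h hE (x := x n)
  gcongr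

theorem coSize_lt (hx : DenseRange x) (hE : E.Nonempty) (hEc : IsClosed E) (h : E ⊆ F) {y : X}
    (hy : y ∈ F) (hyE : y ∉ E) : coSize x F < coSize x E := by
  have hd : 0 < infDist y E := (hEc.notMem_iff_infDist_pos hE).1 hyE
  obtain ⟨n, hn⟩ := hx.exists_dist_lt y (show 0 < min 1 (infDist y E) / 3 by positivity)
  refine Summable.tsum_lt_tsum (i := n) (fun n => ?_) ?_ (summable_coSize x F)
    (summable_coSize x E)
  · have := infDist_le_infDist_of_subset h hE (x := x n)
    gcongr
  · refine mul_lt_mul_of_pos_left ?_ (by positivity)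
    have h1 : infDist (x n) F ≤ dist (x n) y := infDist_le_dist_of_mem hy
    have h2 : infDist y E ≤ infDist (x n) E + dist y (x n) := infDist_le_infDist_add_dist
    rw [dist_comm (x n)] at h1
    have h3 := min_le_left 1 (infDist y E)
    have h4 := min_le_right 1 (infDist y E)
    rw [lt_min_iff]
    constructor
    · exact (min_le_right _ _).trans_lt (by linarith)
    · exact (min_le_right _ _).trans_lt (by linarith)

/-- This gives continuity of the size along a path. The factor 2 is the sum of the weights. -/
theorem coSize_le_add (hE : E.Nonempty) {δ : ℝ} (h : E ⊆ F)
    (hF : ∀ y ∈ F, ∃ z ∈ E, dist y z ≤ δ) :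
    coSize x E ≤ coSize x F + 2 * δ := by
  have hδ : 0 ≤ δ := by
    obtain ⟨y, hy⟩ := hE
    obtain ⟨z, _, hz⟩ := hF y (h hy)
    exact dist_nonneg.trans hz
  have key : ∀ n, infDist (x n) E ≤ infDist (x n) F + δ := fun n => by
    rw [← sub_le_iff_le_add, le_infDist (hE.mono h)]
    intro y hy
    obtain ⟨z, hz, hyz⟩ := hF y hy
    have h1 : infDist (x n) E ≤ dist (x n) z := infDist_le_dist_of_mem hz
    linarith [dist_triangle (x n) y z]
  have hs : Summable fun n : ℕ => (1 / 2 : ℝ) ^ n * δ := summable_geometric_two.mul_right δ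
  have e : ∑' n : ℕ, (1 / 2 : ℝ) ^ n * δ = 2 * δ := by
    rw [tsum_mul_right, tsum_geometric_two]
  rw [← e, coSize, coSize, ← (summable_coSize x F).tsum_add hs]
  refine Summable.tsum_le_tsum (fun n => ?_) (summable_coSize x E) ((summable_coSize x F).add hs)
  rw [← mul_add]
  refine mul_le_mul_of_nonneg_left ?_ (by positivity)
  rcases le_total 1 (infDist (x n) F) with h1 | h1
  · rw [min_eq_left h1]
    exact (min_le_left _ _).trans (by linarith)
  · rw [min_eq_right h1]
    exact (min_le_right _ _).trans (key n)

end coSize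

/-- Every path with distinct end points contains an arc with the same end points. -/
theorem exists_arc_of_path {X : Type*} [MetricSpace X] [TopologicalSpace.SeparableSpace X]
    {f : ℝ → X} {a b : ℝ} (hab : a ≤ b)
    (hf : ContinuousOn f (Icc a b)) (hne : f a ≠ f b) :
    ∃ h : ℝ → X, ContinuousOn h (Icc 0 1) ∧ InjOn h (Icc 0 1) ∧ h 0 = f a ∧ h 1 = f b ∧
      h '' Icc 0 1 ⊆ f '' Icc a b := by
  obtain ⟨C, hC, hmin⟩ := exists_loopErased hab hf
  have hCc : IsCompact C := isCompact_Icc.of_isClosed_subset hC.closed hC.subset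
  have hfC : ContinuousOn f C := hf.mono hC.subset
  have : Nonempty X := ⟨f a⟩
  set x := TopologicalSpace.denseSeq X
  have hx : DenseRange x := TopologicalSpace.denseRange_denseSeq X
  set E : ℝ → Set X := fun t => f '' (C ∩ Icc a t) with hE
  set m : ℝ → ℝ := fun t => coSize x (E t) with hm
  have hEne : ∀ t ∈ C, (E t).Nonempty := fun t ht =>
    ⟨f t, t, ⟨ht, (hC.subset ht).1, le_rfl⟩, rfl⟩
  have hEmono : ∀ {s t}, s ≤ t → E s ⊆ E t := fun h =>
    image_mono (inter_subset_inter_right _ (Icc_subset_Icc_right h))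
  have hEcl : ∀ t, IsClosed (E t) := fun t =>
    ((hCc.inter_right isClosed_Icc).image_of_continuousOn (hfC.mono inter_subset_left)).isClosed
  have hanti : ∀ {s t}, s ∈ C → s ≤ t → m t ≤ m s := fun hs h =>
    coSize_anti (hEne _ hs) (hEmono h)
  have heq : ∀ {s t}, s ∈ C → t ∈ C → s < t → f s = f t → m s = m t := by
    intro s t hs ht hst h
    have : E t = E s := by
      refine Subset.antisymm ?_ (hEmono hst.le)
      rintro _ ⟨u, ⟨hu, hua, hut⟩, rfl⟩
      rcases le_or_gt u s with hus | hus
      · exact ⟨u, ⟨hu, hua, hus⟩, rfl⟩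
      · rcases eq_or_lt_of_le hut with rfl | hut
        · exact ⟨s, ⟨hs, (hC.subset hs).1, le_rfl⟩, h⟩
        · have : u ∈ C ∩ Ioo s t := ⟨hu, hus, hut⟩
          rw [hmin s hs t ht hst h] at this
          exact this.elim
    simp only [hm, this]
  have hlt : ∀ {s t}, s ∈ C → t ∈ C → s < t → f s ≠ f t → m t < m s := by
    intro s t hs ht hst h
    refine coSize_lt hx (hEne s hs) (hEcl s) (hEmono hst.le)
      (y := f t) ⟨t, ⟨ht, (hC.subset ht).1, le_rfl⟩, rfl⟩ ?_
    rintro ⟨u, ⟨hu, hua, hus⟩, hfu⟩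
    rcases eq_or_lt_of_le hus with rfl | hus
    · exact h hfu
    · have : s ∈ C ∩ Ioo u t := ⟨hs, hus, hst⟩
      rw [hmin u hu t ht (hus.trans hst) hfu] at this
      exact this
  -- On `C` the functions `m` and `f` have the same fibres, so `f` factors injectively through the
  -- real parameter `m`. This turns `f '' C` into an arc.
  have hiff : ∀ s ∈ C, ∀ t ∈ C, (m s = m t ↔ f s = f t) := by
    intro s hs t ht
    rcases lt_trichotomy s t with hst | rfl | hst
    · exact ⟨fun h => by_contra fun hn => (hlt hs ht hst hn).ne h.symm, heq hs ht hst⟩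
    · simp
    · exact ⟨fun h => by_contra fun hn => (hlt ht hs hst (Ne.symm hn)).ne h,
        fun h => (heq ht hs hst h.symm).symm⟩
  have hmc : ContinuousOn m C := by
    have huc := hCc.uniformContinuousOn_of_continuous hfC
    rw [Metric.uniformContinuousOn_iff] at huc
    rw [Metric.continuousOn_iff]
    intro s hs ε hε
    obtain ⟨δ, hδ, h⟩ := huc (ε / 3) (by positivity)
    have key : ∀ u ∈ C, ∀ v ∈ C, u ≤ v → dist u v < δ → dist (m u) (m v) < ε := by
      intro u hu v hv huv hd
      have h1 : m u ≤ m v + 2 * (ε / 3) := by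
        refine coSize_le_add (hEne u hu) (hEmono huv) ?_
        rintro _ ⟨w, ⟨hw, hwa, hwv⟩, rfl⟩
        rcases le_or_gt w u with hwu | hwu
        · exact ⟨f w, ⟨w, ⟨hw, hwa, hwu⟩, rfl⟩, by rw [dist_self]; positivity⟩
        · refine ⟨f u, ⟨u, ⟨hu, (hC.subset hu).1, le_rfl⟩, rfl⟩, (h w hw u hu ?_).le⟩
          rw [Real.dist_eq, abs_lt] at hd ⊢
          constructor <;> linarith
      have h2 := hanti hu huv
      rw [Real.dist_eq, abs_lt]
      constructor <;> linarith
    refine ⟨δ, hδ, fun t ht hd => ?_⟩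
    rcases le_total t s with hts | hts
    · exact key t ht s hs hts hd
    · rw [dist_comm] at hd ⊢
      exact key s hs t ht hts hd
  have ha := hC.left_mem
  have hb := hC.right_mem
  have hab' : a < b := lt_of_le_of_ne hab fun h => hne (by rw [h])
  have hmab : m b < m a := hlt ha hb hab' hne
  have hrange : ∀ t ∈ C, m t ∈ Icc (m b) (m a) := fun t ht =>
    ⟨hanti ht (hC.subset ht).2, hanti ha (hC.subset ht).1⟩
  -- Although `C` has gaps, `m` skips no value: it agrees at the two ends of each gap. Here `s` is
  -- the last point with `m ≥ v` and `t` the first later one with `m ≤ v`.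
  have hsurj : ∀ v ∈ Icc (m b) (m a), ∃ t ∈ C, m t = v := by
    intro v hv
    have hcl : IsCompact (C ∩ m ⁻¹' Ici v) :=
      hCc.of_isClosed_subset (hmc.preimage_isClosed_of_isClosed hC.closed isClosed_Ici)
        inter_subset_left
    obtain ⟨s, hs, hsm⟩ := hcl.exists_isGreatest ⟨a, ha, hv.2⟩
    have hcl2 : IsCompact ((C ∩ m ⁻¹' Iic v) ∩ Ici s) :=
      (hCc.of_isClosed_subset (hmc.preimage_isClosed_of_isClosed hC.closed isClosed_Iic)
        inter_subset_left).inter_right isClosed_Ici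
    obtain ⟨t, ht, htm⟩ := hcl2.exists_isLeast ⟨b, ⟨hb, hv.1⟩, (hC.subset hs.1).2⟩
    rcases eq_or_lt_of_le (show s ≤ t from ht.2) with rfl | hst
    · exact ⟨s, hs.1, le_antisymm ht.1.2 hs.2⟩
    · refine ⟨s, hs.1, le_antisymm ?_ hs.2⟩
      have hg : f s = f t := by
        refine hC.gap s hs.1 t ht.1.1 hst (eq_empty_iff_forall_notMem.2 ?_)
        rintro w ⟨hw, hsw, hwt⟩
        rcases le_total v (m w) with h | h
        · exact absurd (hsm ⟨hw, h⟩) (not_le.2 hsw)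
        · exact absurd (htm ⟨⟨hw, h⟩, hsw.le⟩) (not_le.2 hwt)
      rw [heq hs.1 ht.1.1 hst hg]
      exact ht.1.2
  choose c hcC hcm using hsurj
  have : CompactSpace C := isCompact_iff_compactSpace.1 hCc
  set M : C → Icc (m b) (m a) := fun t => ⟨m t, hrange t t.2⟩ with hM
  have hMc : Continuous M := by
    apply Continuous.subtype_mk
    exact continuousOn_iff_continuous_domRestrict.1 hmc
  have hMs : Function.Surjective M := fun v =>
    ⟨⟨c v v.2, hcC v v.2⟩, Subtype.ext (hcm v v.2)⟩
  have hMq := hMc.isClosedMap.isQuotientMap hMc hMs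
  set h₀ : Icc (m b) (m a) → X := fun v => f (c v v.2) with hh₀
  have hh₀m : ∀ t (ht : t ∈ C), h₀ ⟨m t, hrange t ht⟩ = f t := fun t ht =>
    (hiff _ (hcC _ _) _ ht).1 (hcm _ _)
  have hh₀c : Continuous h₀ := by
    rw [hMq.continuous_iff]
    have : h₀ ∘ M = C.domRestrict f := funext fun t => hh₀m t t.2
    rw [this]
    exact continuousOn_iff_continuous_domRestrict.1 hfC
  have hseg : ∀ t ∈ Icc (0 : ℝ) 1, m a + t * (m b - m a) ∈ Icc (m b) (m a) := fun t ht => by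
    constructor <;> nlinarith [ht.1, ht.2]
  refine ⟨fun t => h₀ (projIcc (m b) (m a) hmab.le (m a + t * (m b - m a))), ?_, ?_, ?_, ?_, ?_⟩
  · refine Continuous.continuousOn (hh₀c.comp (continuous_projIcc.comp ?_))
    fun_prop
  · intro s hs t ht hst
    simp only [projIcc_of_mem _ (hseg s hs), projIcc_of_mem _ (hseg t ht), hh₀] at hst
    have := (hiff _ (hcC _ _) _ (hcC _ _)).2 hst
    rw [hcm, hcm] at this
    have h3 : (s - t) * (m b - m a) = 0 := by linarith
    rcases mul_eq_zero.1 h3 with h3 | h3 <;> linarith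
  · simp only [projIcc_of_mem _ (hseg 0 (by simp))]
    rw [← hh₀m a ha]
    congr 2
    ring
  · simp only [projIcc_of_mem _ (hseg 1 (by simp))]
    rw [← hh₀m b hb]
    congr 2
    ring
  · rintro _ ⟨t, ht, rfl⟩
    exact ⟨_, hC.subset (hcC _ _), rfl⟩

/-! ### Loops with non-zero winding number -/

theorem two_pi_le_norm_sub {z w : ℂ} (h : Complex.exp z = Complex.exp w) (hne : z ≠ w) :
    2 * Real.pi ≤ ‖z - w‖ := by
  obtain ⟨n, rfl⟩ := Complex.exp_eq_exp_iff_exists_int.1 h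
  have hn : n ≠ 0 := by
    rintro rfl
    simp at hne
  rw [add_sub_cancel_left, norm_mul, Complex.norm_intCast]
  have h1 : (1 : ℝ) ≤ |(n : ℝ)| := by exact_mod_cast Int.one_le_abs hn
  have h2 : ‖(2 * (Real.pi : ℂ) * Complex.I)‖ = 2 * Real.pi := by
    simp [abs_of_pos Real.pi_pos]
  rw [h2]
  nlinarith [Real.pi_pos]

/-- A closed curve given by a function on `[0, 1]`, injective up to the end points, is a simple
closed curve. -/
theorem exists_circle_of_injective {c : ℝ → ℂ} (hc : ContinuousOn c (Icc 0 1)) (h01 : c 0 = c 1)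
    (hinj : InjOn c (Ico 0 1)) :
    ∃ e : Circle → ℂ, Continuous e ∧ Function.Injective e ∧ range e ⊆ c '' Icc 0 1 := by
  have : Fact ((0 : ℝ) < 1) := ⟨one_pos⟩
  have hq : ∀ x : AddCircle (1 : ℝ), ∃ t ∈ Ico (0 : ℝ) 1, (t : AddCircle (1 : ℝ)) = x := by
    intro x
    have := AddCircle.coe_image_Ico_eq (1 : ℝ) 0
    rw [zero_add] at this
    obtain ⟨t, ht, rfl⟩ := (this ▸ mem_univ x :)
    exact ⟨t, ht, rfl⟩
  refine ⟨fun z => AddCircle.liftIco 1 0 c ((AddCircle.homeomorphCircle one_ne_zero).symm z),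
    (AddCircle.liftIco_zero_continuous h01 hc).comp (Homeomorph.continuous _), ?_, ?_⟩
  · refine Function.Injective.comp (g := AddCircle.liftIco 1 0 c) ?_ (Homeomorph.injective _)
    intro x y hxy
    obtain ⟨s, hs, rfl⟩ := hq x
    obtain ⟨t, ht, rfl⟩ := hq y
    rw [AddCircle.liftIco_zero_coe_apply hs, AddCircle.liftIco_zero_coe_apply ht] at hxy
    rw [hinj hs ht hxy]
  · rintro _ ⟨z, rfl⟩
    obtain ⟨s, hs, h⟩ := hq ((AddCircle.homeomorphCircle one_ne_zero).symm z)
    refine ⟨s, Ico_subset_Icc_self hs, ?_⟩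
    simp only [← h]
    rw [AddCircle.liftIco_zero_coe_apply hs]

/-- If some closed path in `K \ {B}` has non-zero winding number about `B`, then `K` contains a
simple closed curve. The path is given through its logarithm. -/
theorem exists_circle_of_winding {K : Set ℂ} {B z w : ℂ} (hzw : Complex.exp z = Complex.exp w)
    (hne : z ≠ w) (h : JoinedIn {u | B + Complex.exp u ∈ K} z w) :
    ∃ e : Circle → ℂ, Continuous e ∧ Function.Injective e ∧ range e ⊆ K := by
  obtain ⟨p, hp⟩ := h
  set f : ℝ → ℂ := fun t => p.extend t with hf
  have hfc : Continuous f := p.extend.continuous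
  have hfK : ∀ t, B + Complex.exp (f t) ∈ K := fun t => hp _
  -- The bound `2π` replaces the condition that the two logarithms differ. It is equivalent for
  -- points with equal exponentials, and it is closed, so a shortest such pair exists.
  set Q : Set (ℝ × ℝ) := (Icc 0 1 ×ˢ Icc 0 1) ∩ ({q | q.1 ≤ q.2} ∩
    ({q | Complex.exp (f q.1) = Complex.exp (f q.2)} ∩ {q | 2 * Real.pi ≤ ‖f q.1 - f q.2‖})) with hQ
  have hQc : IsCompact Q := by
    have c₁ : IsClosed {q : ℝ × ℝ | q.1 ≤ q.2} := isClosed_le (by fun_prop) (by fun_prop)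
    have c₂ : IsClosed {q : ℝ × ℝ | Complex.exp (f q.1) = Complex.exp (f q.2)} :=
      isClosed_eq (by fun_prop) (by fun_prop)
    have c₃ : IsClosed {q : ℝ × ℝ | 2 * Real.pi ≤ ‖f q.1 - f q.2‖} :=
      isClosed_le (by fun_prop) (by fun_prop)
    exact (isCompact_Icc.prod isCompact_Icc).inter_right (c₁.inter (c₂.inter c₃))
  have hQn : Q.Nonempty := by
    refine ⟨(0, 1), ⟨by simp, by simp⟩, by simp, ?_, ?_⟩
    · simpa [hf] using hzw
    · simpa [hf] using two_pi_le_norm_sub hzw hne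
  obtain ⟨⟨a, b⟩, hab, hmin⟩ := hQc.exists_isMinOn hQn
    (f := fun q : ℝ × ℝ => q.2 - q.1) (by fun_prop)
  have hle : a ≤ b := hab.2.1
  have hexp : Complex.exp (f a) = Complex.exp (f b) := hab.2.2.1
  have hfab : f a ≠ f b := fun h => by
    have : 2 * Real.pi ≤ ‖f a - f b‖ := hab.2.2.2
    rw [h, sub_self, norm_zero] at this
    linarith [Real.pi_pos]
  have key : ∀ s ∈ Icc a b, ∀ t ∈ Icc a b, s ≤ t → Complex.exp (f s) = Complex.exp (f t) →
      f s ≠ f t → s = a ∧ t = b := by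
    intro s hs t ht hst he hn
    have h1 : (s, t) ∈ Q := ⟨⟨⟨hab.1.1.1.trans hs.1, hs.2.trans hab.1.2.2⟩,
      ⟨hab.1.1.1.trans ht.1, ht.2.trans hab.1.2.2⟩⟩, hst, he, two_pi_le_norm_sub he hn⟩
    have h2 : b - a ≤ t - s := hmin h1
    constructor <;> linarith [hs.1, ht.2]
  -- The arc is taken in the logarithmic plane. By minimality of `b - a`, its exponential can only
  -- identify the two end points.
  obtain ⟨h, hc, hinj, h0, h1, hsub⟩ := exists_arc_of_path hle hfc.continuousOn hfab
  have key2 : ∀ s ∈ Ico (0 : ℝ) 1, ∀ t ∈ Ico (0 : ℝ) 1,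
      Complex.exp (h s) = Complex.exp (h t) → s = t := by
    intro s hs t ht he
    by_contra hn
    have hn' : h s ≠ h t := fun h' =>
      hn (hinj (Ico_subset_Icc_self hs) (Ico_subset_Icc_self ht) h')
    obtain ⟨u, hu, hu'⟩ := hsub ⟨s, Ico_subset_Icc_self hs, rfl⟩
    obtain ⟨v, hv, hv'⟩ := hsub ⟨t, Ico_subset_Icc_self ht, rfl⟩
    have h11 : ∀ r ∈ Ico (0 : ℝ) 1, h r ≠ f b := fun r hr hrb => by
      have := hinj (Ico_subset_Icc_self hr) (right_mem_Icc.2 zero_le_one) (hrb.trans h1.symm)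
      exact hr.2.ne this
    rw [← hu', ← hv'] at he hn'
    rcases le_total u v with huv | huv
    · obtain ⟨-, rfl⟩ := key u hu v hv huv he hn'
      exact h11 t ht hv'.symm
    · obtain ⟨-, rfl⟩ := key v hv u hu huv he.symm hn'.symm
      exact h11 s hs hu'.symm
  obtain ⟨e, hec, hei, her⟩ := exists_circle_of_injective
    (c := fun t => B + Complex.exp (h t)) (by fun_prop) (by simp only [h0, h1, hexp])
    (fun s hs t ht hst => key2 s hs t ht (add_left_cancel hst))
  refine ⟨e, hec, hei, her.trans ?_⟩
  rintro _ ⟨t, ht, rfl⟩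
  obtain ⟨u, -, hu⟩ := hsub ⟨t, ht, rfl⟩
  simp only [← hu]
  exact hfK u

/-! ### Spirals -/

/-- `K` contains a curve which spirals towards `B`, invariant under the similarity with fixed
point `B` and multiplier `exp v`; here `t * v + p t` is the logarithm of the curve. -/
def HasSpiral (K : Set ℂ) (B v : ℂ) : Prop :=
  ∃ (p : ℝ → ℂ) (R : ℝ), Continuous p ∧ (∀ t, ‖p t‖ ≤ R) ∧
    ∀ t, 0 ≤ t → B + Complex.exp (t * v + p t) ∈ K

/-- Two curves which stay at bounded distances from two half-lines meet after a translation by a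
vector lying deep inside the cone spanned by the directions. -/
theorem exists_crossing {v₁ v₂ : ℂ} {p₁ p₂ : ℝ → ℂ} (hp₁ : Continuous p₁) (hp₂ : Continuous p₂)
    {R : ℝ} (hR₁ : ∀ t, ‖p₁ t‖ ≤ R) (hR₂ : ∀ t, ‖p₂ t‖ ≤ R) (Φ : ℂ →L[ℝ] ℝ × ℝ)
    (hΦ : ∀ z, (Φ z).1 * v₁ - (Φ z).2 * v₂ = z) {c : ℂ} (hc₁ : ‖Φ‖ * (2 * R) ≤ (Φ c).1)
    (hc₂ : ‖Φ‖ * (2 * R) ≤ (Φ c).2) :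
    ∃ s t : ℝ, 0 ≤ s ∧ 0 ≤ t ∧ s * v₁ + p₁ s = t * v₂ + p₂ t + c := by
  -- With `Φ z = (s, t)`, the required equation `s v₁ - t v₂ = c + p₂ t - p₁ s` says that `z` is a
  -- fixed point of the bounded map `z ↦ c + d z`.
  set d : ℂ → ℂ := fun z => p₂ (Φ z).2 - p₁ (Φ z).1 with hd
  have hdR : ∀ z, ‖d z‖ ≤ 2 * R := fun z =>
    (norm_sub_le _ _).trans (by linarith [hR₁ (Φ z).1, hR₂ (Φ z).2])
  obtain ⟨z, hz⟩ := exists_fixedPoint_of_bounded (b := fun z => c + d z) (R := ‖c‖ + 2 * R)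
    (by fun_prop) (fun z => (norm_add_le _ _).trans (by linarith [hdR z]))
  have hn : ‖Φ (d z)‖ ≤ ‖Φ‖ * (2 * R) := (Φ.le_opNorm _).trans (by gcongr; exact hdR z)
  have e : Φ z = Φ c + Φ (d z) := by
    conv_lhs => rw [← hz, map_add]
  have h1 := (norm_fst_le (Φ (d z))).trans hn
  have h2 := (norm_snd_le (Φ (d z))).trans hn
  rw [Real.norm_eq_abs, abs_le] at h1 h2
  refine ⟨(Φ z).1, (Φ z).2, ?_, ?_, ?_⟩
  · rw [e, Prod.fst_add]
    linarith
  · rw [e, Prod.snd_add]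
    linarith
  · have h3 := hΦ z
    have h4 : z = c + (p₂ (Φ z).2 - p₁ (Φ z).1) := hz.symm
    rw [← sub_eq_zero]
    calc _ = ((Φ z).1 * v₁ - (Φ z).2 * v₂) - (c + (p₂ (Φ z).2 - p₁ (Φ z).1)) := by ring
      _ = 0 := by rw [h3, ← h4, sub_self]

/-- The period `c` allows the same arc of the spiral to be lifted to another branch of the
logarithm. -/
theorem HasSpiral.joinedIn {K : Set ℂ} {B v : ℂ} {p : ℝ → ℂ} (hp : Continuous p)
    (h : ∀ t : ℝ, 0 ≤ t → B + Complex.exp (t * v + p t) ∈ K) (c : ℂ) (hc : Complex.exp c = 1)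
    {s t : ℝ} (hs : 0 ≤ s) (ht : 0 ≤ t) :
    JoinedIn {u | B + Complex.exp u ∈ K} (s * v + p s + c) (t * v + p t + c) := by
  refine JoinedIn.ofLine (f := fun r : ℝ => ((s + r * (t - s) : ℝ) : ℂ) * v + p (s + r * (t - s)) + c)
    (by fun_prop) (by simp) (by simp) ?_
  rintro _ ⟨r, hr, rfl⟩
  simp only [mem_ofPred_eq]
  rw [Complex.exp_add, hc, mul_one]
  exact h _ (by nlinarith [hr.1, hr.2])

/-- In a planar set without simple closed curves, two invariant curves spiralling towards the same
point do it at the same rate. -/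
theorem HasSpiral.slope_eq {K : Set ℂ}
    (hK : ¬ ∃ c : Circle → ℂ, Continuous c ∧ Function.Injective c ∧ range c ⊆ K) {B v₁ v₂ : ℂ}
    (h₁ : HasSpiral K B v₁) (h₂ : HasSpiral K B v₂) (hv₁ : v₁.re < 0) (hv₂ : v₂.re < 0) :
    v₁.im / v₁.re = v₂.im / v₂.re := by
  by_contra hne
  set D : ℝ := v₁.im * v₂.re - v₁.re * v₂.im with hD
  have hD0 : D ≠ 0 := fun h => hne (by
    rw [div_eq_div_iff hv₁.ne hv₂.ne]; linarith)
  obtain ⟨p₁, R₁, hp₁, hR₁, hs₁⟩ := h₁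
  obtain ⟨p₂, R₂, hp₂, hR₂, hs₂⟩ := h₂
  set R := max R₁ R₂
  -- Cramer's rule for `s v₁ - t v₂ = z`, whose determinant is `±D`.
  set Φ : ℂ →L[ℝ] ℝ × ℝ :=
    ((D⁻¹ * v₂.re) • Complex.imCLM - (D⁻¹ * v₂.im) • Complex.reCLM).prod
    ((D⁻¹ * v₁.re) • Complex.imCLM - (D⁻¹ * v₁.im) • Complex.reCLM) with hΦ
  have hΦ1 : ∀ z, (Φ z).1 = D⁻¹ * v₂.re * z.im - D⁻¹ * v₂.im * z.re := fun z => rfl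
  have hΦ2 : ∀ z, (Φ z).2 = D⁻¹ * v₁.re * z.im - D⁻¹ * v₁.im * z.re := fun z => rfl
  have hinv : ∀ z, (Φ z).1 * v₁ - (Φ z).2 * v₂ = z := by
    intro z
    have hDD : D⁻¹ * D = 1 := inv_mul_cancel₀ hD0
    apply Complex.ext
    · simp only [Complex.sub_re, Complex.re_ofReal_mul, hΦ1, hΦ2]
      linear_combination z.re * hDD + D⁻¹ * z.re * hD
    · simp only [Complex.sub_im, Complex.im_ofReal_mul, hΦ1, hΦ2]
      linear_combination z.im * hDD + D⁻¹ * z.im * hD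
  -- The sign condition puts the vertical shift inside the cone where both coordinates of `Φ` are
  -- positive, since `v₁` and `v₂` have negative real parts; a large `j` then beats the bounded
  -- terms.
  have hcross : ∀ ε : ℝ, ε * D < 0 → ∃ N : ℕ, ∀ j : ℕ, N ≤ j → ∃ s t : ℝ, 0 ≤ s ∧ 0 ≤ t ∧
      s * v₁ + p₁ s = t * v₂ + p₂ t + j * (2 * Real.pi * ε) * Complex.I := by
    intro ε hε
    have hεD : ε * D⁻¹ < 0 := by
      have : ε * D⁻¹ = ε * D * (D⁻¹) ^ 2 := by field_simp
      rw [this]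
      exact mul_neg_of_neg_of_pos hε (by positivity)
    set μ : ℝ := min (2 * Real.pi * (ε * D⁻¹ * v₂.re)) (2 * Real.pi * (ε * D⁻¹ * v₁.re))
    have hμ : 0 < μ := lt_min (mul_pos (by positivity) (mul_pos_of_neg_of_neg hεD hv₂))
      (mul_pos (by positivity) (mul_pos_of_neg_of_neg hεD hv₁))
    obtain ⟨N, hN⟩ := exists_nat_ge (‖Φ‖ * (2 * R) / μ)
    refine ⟨N, fun j hj => ?_⟩
    have hj' : ‖Φ‖ * (2 * R) ≤ j * μ := by
      rw [div_le_iff₀ hμ] at hN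
      exact hN.trans (by gcongr)
    have him : ((j : ℂ) * (2 * Real.pi * ε) * Complex.I).im = j * (2 * Real.pi * ε) := by
      simp
    have hre : ((j : ℂ) * (2 * Real.pi * ε) * Complex.I).re = 0 := by
      simp
    refine exists_crossing hp₁ hp₂ (fun t => (hR₁ t).trans (le_max_left _ _))
      (fun t => (hR₂ t).trans (le_max_right _ _)) Φ hinv (hj'.trans ?_) (hj'.trans ?_)
    · rw [hΦ1, him, hre]
      have : (j : ℝ) * μ ≤ j * (2 * Real.pi * (ε * D⁻¹ * v₂.re)) := by
        gcongr
        exact min_le_left _ _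
      linarith
    · rw [hΦ2, him, hre]
      have : (j : ℝ) * μ ≤ j * (2 * Real.pi * (ε * D⁻¹ * v₁.re)) := by
        gcongr
        exact min_le_right _ _
      linarith
  obtain ⟨ε, hε, hεD⟩ : ∃ ε : ℤ, (ε = 1 ∨ ε = -1) ∧ (ε : ℝ) * D < 0 := by
    rcases lt_or_gt_of_ne hD0 with h | h
    · exact ⟨1, Or.inl rfl, by simpa using h⟩
    · exact ⟨-1, Or.inr rfl, by simpa using h⟩
  have hε0 : (ε : ℂ) ≠ 0 := by rcases hε with rfl | rfl <;> simp
  -- Two consecutive shifts are used. Following the first curve between the crossings, then the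
  -- second one lifted with shift `N`, gives a path whose ends differ by one period.
  obtain ⟨N, hN⟩ := hcross ε hεD
  obtain ⟨s, t, hs, ht, hst⟩ := hN N le_rfl
  obtain ⟨s', t', hs', ht', hst'⟩ := hN (N + 1) (Nat.le_succ N)
  have hexp : ∀ j : ℕ, Complex.exp (j * (2 * Real.pi * (ε : ℝ)) * Complex.I) = 1 := fun j => by
    rw [Complex.exp_eq_one_iff]
    exact ⟨j * ε, by push_cast; ring⟩
  have J₁ := HasSpiral.joinedIn hp₁ hs₁ 0 Complex.exp_zero hs' hs
  have J₂ := HasSpiral.joinedIn hp₂ hs₂ _ (hexp N) ht ht'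
  rw [add_zero, add_zero, hst] at J₁
  have J := J₁.trans J₂
  refine hK (exists_circle_of_winding ?_ ?_ J)
  · rw [hst', Complex.exp_add _ (_ * Complex.I), Complex.exp_add _ (_ * Complex.I), hexp, hexp]
  · rw [hst']
    intro h
    have h' := add_left_cancel h
    have h2 : (2 * Real.pi * (ε : ℂ)) * Complex.I = 0 := by
      push_cast at h'
      linear_combination h'
    simp [hε0, Real.pi_ne_zero] at h2

/-! ### Words -/

section words

variable {m : ℕ} (S : Fin m → ContractingSimilarity)

/-- The multiplier of the similarity `S_w`. -/
noncomputable def wordMult (w : List (Fin m)) : ℂ := (w.map fun k => (S k).mult).prod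

@[simp] theorem wordMult_nil : wordMult S [] = 1 := rfl

@[simp] theorem wordMult_cons (k : Fin m) (w : List (Fin m)) :
    wordMult S (k :: w) = (S k).mult * wordMult S w := by
  simp [wordMult]

theorem wordMap_sub (w : List (Fin m)) (z z' : ℂ) :
    wordMap S w z - wordMap S w z' = wordMult S w * (z - z') := by
  induction w with
  | nil => simp [wordMap]
  | cons k w ih =>
    simp only [wordMap, ContractingSimilarity.toFun, wordMult_cons]
    linear_combination (S k).mult * ih

theorem wordMap_eq (w : List (Fin m)) (z z' : ℂ) :
    wordMap S w z = wordMult S w * (z - z') + wordMap S w z' := by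
  rw [← wordMap_sub, sub_add_cancel]

theorem wordMult_ne_zero (w : List (Fin m)) : wordMult S w ≠ 0 := by
  induction w with
  | nil => simp
  | cons k w ih => simpa using ⟨(S k).mult_ne_zero, ih⟩

theorem norm_wordMult_le_one (w : List (Fin m)) : ‖wordMult S w‖ ≤ 1 := by
  induction w with
  | nil => simp
  | cons k w ih =>
    rw [wordMult_cons, norm_mul]
    exact mul_le_one₀ (S k).norm_mult_lt_one.le (norm_nonneg _) ih

theorem norm_wordMult_lt_one {w : List (Fin m)} (hw : w ≠ []) : ‖wordMult S w‖ < 1 := by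
  cases w with
  | nil => exact absurd rfl hw
  | cons k w =>
    rw [wordMult_cons, norm_mul]
    exact mul_lt_one_of_nonneg_of_lt_one_left (norm_nonneg _) (S k).norm_mult_lt_one
      (norm_wordMult_le_one S w)

theorem wordMap_append (u w : List (Fin m)) (z : ℂ) :
    wordMap S (u ++ w) z = wordMap S u (wordMap S w z) := by
  induction u with
  | nil => rfl
  | cons k u ih => simp only [List.cons_append, wordMap, ih]

theorem wordMap_flatten_replicate (w : List (Fin m)) (n : ℕ) :
    wordMap S (List.replicate n w).flatten = (wordMap S w)^[n] := by
  induction n with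
  | zero => rfl
  | succ n ih =>
    funext z
    rw [List.replicate_succ, List.flatten_cons, wordMap_append, ih, Function.iterate_succ_apply']

theorem continuous_wordMap (w : List (Fin m)) : Continuous (wordMap S w) := by
  have : wordMap S w = fun z => wordMult S w * (z - 0) + wordMap S w 0 :=
    funext fun z => wordMap_eq S w z 0
  rw [this]
  fun_prop

theorem wordMap_injective (w : List (Fin m)) : Function.Injective (wordMap S w) := by
  intro z z' h
  have := wordMap_sub S w z z'
  rw [h, sub_self, eq_comm, mul_eq_zero] at this
  exact sub_eq_zero.1 (this.resolve_left (wordMult_ne_zero S w))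

variable {S}

theorem IsAttractor.map_mem {K : Set ℂ} (hK : IsAttractor S K) (k : Fin m) {z : ℂ} (hz : z ∈ K) :
    S k z ∈ K := by
  rw [hK.2.2]
  exact mem_iUnion.2 ⟨k, z, hz, rfl⟩

theorem IsAttractor.wordMap_mem {K : Set ℂ} (hK : IsAttractor S K) (w : List (Fin m)) {z : ℂ}
    (hz : z ∈ K) : wordMap S w z ∈ K := by
  induction w with
  | nil => exact hz
  | cons k w ih => exact hK.map_mem k ih

theorem IsAttractor.iterate_mem {K : Set ℂ} (hK : IsAttractor S K) (w : List (Fin m)) {z : ℂ}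
    (hz : z ∈ K) (n : ℕ) : (wordMap S w)^[n] z ∈ K := by
  rw [← wordMap_flatten_replicate]
  exact hK.wordMap_mem _ hz

theorem iterate_sub_of_fixed {w : List (Fin m)} {A : ℂ} (hA : wordMap S w A = A) (n : ℕ) (z : ℂ) :
    (wordMap S w)^[n] z - A = wordMult S w ^ n * (z - A) := by
  induction n with
  | zero => simp
  | succ n ih =>
    rw [Function.iterate_succ_apply']
    rw [wordMap_eq S w _ A, hA]
    linear_combination wordMult S w * ih

theorem IsAttractor.fixed_mem {K : Set ℂ} (hK : IsAttractor S K) {w : List (Fin m)} (hw : w ≠ [])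
    {A : ℂ} (hA : wordMap S w A = A) : A ∈ K := by
  obtain ⟨z, hz⟩ := hK.1
  have h1 : Filter.Tendsto (fun n => wordMult S w ^ n * (z - A) + A) Filter.atTop
      (nhds (0 * (z - A) + A)) :=
    ((tendsto_pow_atTop_nhds_zero_of_norm_lt_one (norm_wordMult_lt_one S hw)).mul_const _).add_const _
  rw [zero_mul, zero_add] at h1
  refine hK.2.1.isClosed.mem_of_tendsto h1 (Filter.Eventually.of_forall fun n => ?_)
  rw [← iterate_sub_of_fixed hA, sub_add_cancel]
  exact hK.iterate_mem w hz n

end words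

/-! ### Parameters as slopes of spirals -/

/-- The path of the parameter is a fundamental piece: its images under the powers of `S_w` fit
together end to end, and `S_u` adds only a constant to the logarithm. -/
theorem IsParameter.exists_spiral {m : ℕ} {S : Fin m → ContractingSimilarity} {K : Set ℂ}
    (hK : IsAttractor S K) {A : ℂ} {lam : ℝ} (h : IsParameter S K A lam) (u : List (Fin m)) :
    ∃ v : ℂ, v.re < 0 ∧ lam = v.im / v.re ∧ HasSpiral K (wordMap S u A) v := by
  obtain ⟨w, r, α, hw, hr, hS, ⟨x, γ, θ, hγ, hθ, hmem, harg, h0, h1, hα⟩, rfl⟩ := h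
  have hA : wordMap S w A = A := by rw [hS]; simp
  have hmult : wordMult S w = r * Complex.exp (α * Complex.I) := by
    have e1 := wordMap_sub S w (A + 1) A
    have e2 := hS (A + 1)
    rw [hA] at e1
    linear_combination -e1 + e2
  have hr1 : r < 1 := by
    have := norm_wordMult_lt_one S hw
    rwa [hmult, norm_mul, Complex.norm_exp_ofReal_mul_I, mul_one, Complex.norm_real,
      Real.norm_eq_abs, abs_of_pos hr] at this
  set v : ℂ := Real.log r + α * Complex.I with hv
  have hvre : v.re = Real.log r := by simp [hv]
  have hvim : v.im = α := by simp [hv]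
  have hvexp : Complex.exp v = wordMult S w := by
    rw [hv, Complex.exp_add, ← Complex.ofReal_exp, Real.exp_log hr, hmult]
  have hne : ∀ t ∈ Icc (0 : ℝ) 1, γ t - A ≠ 0 := fun t ht => sub_ne_zero.2 (hmem t ht).2
  set l : ℝ → ℂ := fun t => Real.log ‖γ t - A‖ + θ t * Complex.I with hl
  have hlexp : ∀ t ∈ Icc (0 : ℝ) 1, Complex.exp (l t) = γ t - A := fun t ht => by
    rw [hl]
    simp only
    rw [Complex.exp_add, ← Complex.ofReal_exp, Real.exp_log (norm_pos_iff.2 (hne t ht)), ← harg t ht]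
  have hlc : ContinuousOn l (Icc 0 1) := by
    have : ContinuousOn (fun t => Real.log ‖γ t - A‖) (Icc 0 1) :=
      ContinuousOn.log (by fun_prop) fun t ht => norm_ne_zero_iff.2 (hne t ht)
    have h2 := Complex.continuous_ofReal.comp_continuousOn this
    have h3 := Complex.continuous_ofReal.comp_continuousOn hθ
    exact h2.add (h3.mul continuousOn_const)
  have hl1 : l 1 = l 0 + v := by
    have e : ‖γ 1 - A‖ = r * ‖γ 0 - A‖ := by
      rw [h1, hS, add_sub_cancel_right, h0, norm_mul, norm_mul, Complex.norm_exp_ofReal_mul_I,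
        mul_one, Complex.norm_real, Real.norm_eq_abs, abs_of_pos hr]
    simp only [hl, hv]
    rw [e, Real.log_mul hr.ne' (norm_ne_zero_iff.2 (hne 0 (by simp))), ← hα]
    push_cast
    ring
  set c : ℂ := Complex.log (wordMult S u)
  -- Without its linear part the logarithm takes equal values at 0 and 1, so it extends periodically
  -- and stays bounded.
  set q : ℝ → ℂ := fun t => l t - t * v + c with hq
  have hqc : ContinuousOn q (Icc 0 1) := by fun_prop
  have hq01 : q 0 = q 1 := by
    simp only [hq, hl1]
    push_cast
    ring
  obtain ⟨R, hR⟩ := isCompact_Icc.exists_bound_of_continuousOn hqc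
  have hfr : ∀ t : ℝ, Int.fract t ∈ Icc (0 : ℝ) 1 :=
    fun t => ⟨Int.fract_nonneg t, (Int.fract_lt_one t).le⟩
  refine ⟨v, by rw [hvre]; exact Real.log_neg hr hr1, by rw [hvre, hvim], fun t => q (Int.fract t), R,
    ContinuousOn.comp_fract'' hqc hq01, fun t => hR _ (hfr t), fun t ht => ?_⟩
  have ht' : (t : ℂ) = (⌊t⌋₊ : ℂ) + (Int.fract t : ℝ) := by
    have : t = (⌊t⌋₊ : ℝ) + Int.fract t := by
      rw [natCast_floor_eq_intCast_floor ht, Int.floor_add_fract]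
    exact_mod_cast congrArg (fun x : ℝ => (x : ℂ)) this
  have e : wordMap S u A + Complex.exp (t * v + q (Int.fract t)) =
      wordMap S u ((wordMap S w)^[⌊t⌋₊] (γ (Int.fract t))) := by
    rw [wordMap_eq S u ((wordMap S w)^[_] _) A, iterate_sub_of_fixed hA, ← hlexp _ (hfr t), ← hvexp, ← Complex.exp_nat_mul,
      ← Complex.exp_log (wordMult_ne_zero S u), ← Complex.exp_add, ← Complex.exp_add, add_comm]
    congr 2
    simp only [hq]
    nth_rewrite 1 [ht']
    ring
  rw [e]
  exact hK.wordMap_mem _ (hK.iterate_mem _ (hmem _ (hfr t)).1 _)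

/-- Parameters of points which are mapped to the same point agree. -/
theorem IsParameter.eq_of_wordMap_eq {m : ℕ} {S : Fin m → ContractingSimilarity} {K : Set ℂ}
    (hK : IsAttractor S K)
    (hcirc : ¬ ∃ c : Circle → ℂ, Continuous c ∧ Function.Injective c ∧ range c ⊆ K)
    {A A' : ℂ} {lam lam' : ℝ} (h : IsParameter S K A lam) (h' : IsParameter S K A' lam')
    {u u' : List (Fin m)} (huu : wordMap S u A = wordMap S u' A') : lam = lam' := by
  obtain ⟨v, hv, rfl, hs⟩ := h.exists_spiral hK u
  obtain ⟨v', hv', rfl, hs'⟩ := h'.exists_spiral hK u'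
  exact HasSpiral.slope_eq hcirc hs (huu ▸ hs') hv hv'

/-! ### A connected attractor is path connected -/

theorem ContractingSimilarity.continuous (s : ContractingSimilarity) : Continuous s := by
  change Continuous fun z => s.mult * (z - s.fix) + s.fix
  fun_prop

theorem ContractingSimilarity.dist_map (s : ContractingSimilarity) (z w : ℂ) :
    dist (s z) (s w) = ‖s.mult‖ * dist z w := by
  rw [dist_eq_norm, dist_eq_norm, ← norm_mul]
  congr 1
  simp only [ContractingSimilarity.toFun]
  ring

theorem exists_ratio_bound {m : ℕ} (S : Fin m → ContractingSimilarity) :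
    ∃ r : ℝ, 0 ≤ r ∧ r < 1 ∧ ∀ k, ‖(S k).mult‖ ≤ r := by
  refine ⟨(Finset.univ.sup fun k => ‖(S k).mult‖₊ : NNReal), NNReal.coe_nonneg _, ?_, fun k => ?_⟩
  · rw [← NNReal.coe_one, NNReal.coe_lt_coe, Finset.sup_lt_iff (by simp)]
    exact fun k _ => (S k).norm_mult_lt_one
  · exact NNReal.coe_le_coe.2 (Finset.le_sup (f := fun k => ‖(S k).mult‖₊) (Finset.mem_univ k))

/-- A chain of pairs of points of `K`, each pair lying in one of the pieces `S k '' K`. -/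
inductive PieceChain {m : ℕ} (S : Fin m → ContractingSimilarity) (K : Set ℂ) : ℂ → ℂ → Type
  | piece (k : Fin m) (x y : ℂ) (hx : x ∈ K) (hy : y ∈ K) : PieceChain S K (S k x) (S k y)
  | trans {x y z : ℂ} (p : PieceChain S K x y) (q : PieceChain S K y z) : PieceChain S K x z

section attractor

variable {m : ℕ} {S : Fin m → ContractingSimilarity} {K : Set ℂ}

/-- The pieces reachable from `x` and the remaining ones form two finite closed families covering
`K`; connectedness forces them to meet, which makes an unreachable piece reachable. -/
theorem IsAttractor.nonempty_pieceChain (hK : IsAttractor S K) (hc : IsConnected K) {x y : ℂ}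
    (hx : x ∈ K) (hy : y ∈ K) : Nonempty (PieceChain S K x y) := by
  by_contra hxy
  set J : Set (Fin m) := {k | ∃ z ∈ K, Nonempty (PieceChain S K x (S k z))} with hJ
  have hcl : ∀ I : Set (Fin m), IsClosed (⋃ k ∈ I, S k '' K) := fun I =>
    (toFinite I).isClosed_biUnion fun k _ => (hK.2.1.image (S k).continuous).isClosed
  have hcov : ∀ z ∈ K, ∃ k, ∃ z' ∈ K, S k z' = z := fun z hz => by
    rw [hK.2.2] at hz
    obtain ⟨k, z', hz', h⟩ := mem_iUnion.1 hz
    exact ⟨k, z', hz', h⟩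
  have hstep : ∀ k ∈ J, ∀ z ∈ K, Nonempty (PieceChain S K x (S k z)) := by
    rintro k ⟨z', hz', ⟨p⟩⟩ z hz
    exact ⟨p.trans (.piece k z' z hz' hz)⟩
  obtain ⟨k₀, x', hx', rfl⟩ := hcov x hx
  obtain ⟨k₁, y', hy', rfl⟩ := hcov y hy
  obtain ⟨z, hz, hz1, hz2⟩ := isPreconnected_closed_iff.1 hc.isPreconnected _ _ (hcl J) (hcl Jᶜ)
    (fun z hz => by
      obtain ⟨k, z', hz', rfl⟩ := hcov z hz
      by_cases hk : k ∈ J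
      · exact Or.inl (mem_biUnion hk ⟨z', hz', rfl⟩)
      · exact Or.inr (mem_biUnion (show k ∈ Jᶜ from hk) ⟨z', hz', rfl⟩))
    ⟨_, hx, mem_biUnion (show k₀ ∈ J from ⟨x', hx', ⟨.piece k₀ x' x' hx' hx'⟩⟩) ⟨x', hx', rfl⟩⟩
    ⟨_, hy, mem_biUnion (show k₁ ∈ Jᶜ from fun h => hxy (hstep k₁ h y' hy')) ⟨y', hy', rfl⟩⟩
  obtain ⟨k, hk, u, hu, rfl⟩ := mem_iUnion₂.1 hz1
  obtain ⟨k', hk', u', hu', h⟩ := mem_iUnion₂.1 hz2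
  exact hk' ⟨u', hu', h ▸ hstep k hk u hu⟩

/-- Replace each pair of a chain by the corresponding image of a path of the family `Φ`. -/
noncomputable def PieceChain.toPath (Φ : ∀ x y : ℂ, Path x y) :
    ∀ {x y : ℂ}, PieceChain S K x y → Path x y
  | _, _, .piece k x y _ _ => (Φ x y).map (S k).continuous
  | _, _, .trans p q => (p.toPath Φ).trans (q.toPath Φ)

/-- Both concatenations split time in the same way, so at each `t` the two points come from the same
link of the chain. -/
theorem PieceChain.toPath_induction {Φ Ψ : ∀ x y : ℂ, Path x y} {R : ℂ → ℂ → Prop}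
    (h : ∀ k, ∀ x ∈ K, ∀ y ∈ K, ∀ t, R (S k (Φ x y t)) (S k (Ψ x y t))) {x y : ℂ}
    (c : PieceChain S K x y) (t : unitInterval) : R (c.toPath Φ t) (c.toPath Ψ t) := by
  induction c generalizing t with
  | piece k x y hx hy => exact h k x hx y hy t
  | trans p q ihp ihq =>
    simp only [PieceChain.toPath, Path.trans_apply]
    split_ifs
    · exact ihp _
    · exact ihq _

open Classical in
/-- The refinement of a family of paths along a family of chains. -/
noncomputable def refinePaths (c : ∀ x ∈ K, ∀ y ∈ K, PieceChain S K x y)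
    (Φ : ∀ x y : ℂ, Path x y) (x y : ℂ) : Path x y :=
  if h : x ∈ K ∧ y ∈ K then (c x h.1 y h.2).toPath Φ else Φ x y

theorem refinePaths_induction (c : ∀ x ∈ K, ∀ y ∈ K, PieceChain S K x y)
    {Φ Ψ : ∀ x y : ℂ, Path x y} {R : ℂ → ℂ → Prop}
    (h : ∀ k, ∀ x ∈ K, ∀ y ∈ K, ∀ t, R (S k (Φ x y t)) (S k (Ψ x y t))) :
    ∀ x ∈ K, ∀ y ∈ K, ∀ t, R (refinePaths c Φ x y t) (refinePaths c Ψ x y t) := by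
  intro x hx y hy t
  simp only [refinePaths, dif_pos (And.intro hx hy)]
  exact PieceChain.toPath_induction h _ t

/-- A connected attractor of a finite system of contractions is path connected. -/
theorem IsAttractor.joinedIn (hK : IsAttractor S K) (hc : IsConnected K) {x y : ℂ}
    (hx : x ∈ K) (hy : y ∈ K) : JoinedIn K x y := by
  set c : ∀ x ∈ K, ∀ y ∈ K, PieceChain S K x y := fun x hx y hy =>
    (hK.nonempty_pieceChain hc hx hy).some
  obtain ⟨r, hr0, hr1, hr⟩ := exists_ratio_bound S
  obtain ⟨M, hM⟩ := hK.2.1.isBounded.exists_norm_le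
  have hM0 : 0 ≤ M := (norm_nonneg x).trans (hM x hx)
  set Φ₀ : ∀ x y : ℂ, Path x y := fun x y => Path.segment x y
  -- Each refinement applies the contractions once more, so distances to `K` and between successive
  -- paths shrink like `r ^ n`. The uniform limit is a path in `K`.
  set Φ : ℕ → ∀ x y : ℂ, Path x y := fun n => (refinePaths c)^[n] Φ₀ with hΦ
  have hΦs : ∀ n, Φ (n + 1) = refinePaths c (Φ n) := fun n => Function.iterate_succ_apply' _ _ _
  have hball : ∀ x ∈ K, ∀ y ∈ K, ∀ t, ‖Φ₀ x y t‖ ≤ M := fun x hx y hy t => by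
    rw [← mem_closedBall_zero_iff]
    refine (convex_closedBall (0 : ℂ) M).segment_subset (mem_closedBall_zero_iff.2 (hM x hx))
      (mem_closedBall_zero_iff.2 (hM y hy)) ?_
    rw [← Path.range_segment]
    exact mem_range_self t
  have hdist0 : ∀ x ∈ K, ∀ w, ‖w‖ ≤ M → dist w x ≤ 2 * M := fun x hx w hw => by
    rw [dist_eq_norm]
    exact (norm_sub_le _ _).trans (by linarith [hM x hx])
  have hnear : ∀ n, ∀ x ∈ K, ∀ y ∈ K, ∀ t, ∃ z ∈ K, dist (Φ n x y t) z ≤ 2 * M * r ^ n := by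
    intro n
    induction n with
    | zero =>
      intro x hx y hy t
      refine ⟨x, hx, ?_⟩
      rw [pow_zero, mul_one]
      exact hdist0 x hx _ (hball x hx y hy t)
    | succ n ih =>
      rw [hΦs]
      refine refinePaths_induction (Ψ := Φ n) (R := fun u _ => ∃ z ∈ K, dist u z ≤ 2 * M * r ^ (n + 1))
        c ?_
      intro k x hx y hy t
      obtain ⟨z, hz, h⟩ := ih x hx y hy t
      refine ⟨S k z, hK.map_mem k hz, ?_⟩
      rw [ContractingSimilarity.dist_map]
      calc ‖(S k).mult‖ * dist (Φ n x y t) z ≤ r * (2 * M * r ^ n) :=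
            mul_le_mul (hr k) h dist_nonneg hr0
        _ = _ := by ring
  have hstep : ∀ n, ∀ x ∈ K, ∀ y ∈ K, ∀ t, dist (Φ n x y t) (Φ (n + 1) x y t) ≤ 4 * M * r ^ n := by
    intro n
    induction n with
    | zero =>
      intro x hx y hy t
      obtain ⟨z, hz, h⟩ := hnear 1 x hx y hy t
      have h1 := hdist0 z hz _ (hball x hx y hy t)
      have h2 : 2 * M * r ^ 1 ≤ 2 * M := by
        rw [pow_one]
        exact mul_le_of_le_one_right (by positivity) hr1.le
      calc dist (Φ 0 x y t) (Φ 1 x y t) ≤ dist (Φ 0 x y t) z + dist (Φ 1 x y t) z :=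
            dist_triangle_right _ _ _
        _ ≤ 2 * M + 2 * M := add_le_add h1 (h.trans h2)
        _ = _ := by ring
    | succ n ih =>
      have h : ∀ x ∈ K, ∀ y ∈ K, ∀ t, dist (refinePaths c (Φ n) x y t)
          (refinePaths c (Φ (n + 1)) x y t) ≤ 4 * M * r ^ (n + 1) := ?_
      · rwa [← hΦs, ← hΦs] at h
      refine refinePaths_induction (Ψ := Φ (n + 1))
        (R := fun u v => dist u v ≤ 4 * M * r ^ (n + 1)) c ?_
      intro k x hx y hy t
      rw [ContractingSimilarity.dist_map]
      calc ‖(S k).mult‖ * dist (Φ n x y t) (Φ (n + 1) x y t) ≤ r * (4 * M * r ^ n) :=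
            mul_le_mul (hr k) (ih x hx y hy t) dist_nonneg hr0
        _ = _ := by ring
  set F : ℕ → C(unitInterval, ℂ) := fun n => ⟨Φ n x y, (Φ n x y).continuous⟩ with hF
  have hcs : CauchySeq F := by
    refine cauchySeq_of_le_geometric r (4 * M) hr1 fun n => ?_
    exact (ContinuousMap.dist_le (by positivity)).2 fun t => hstep n x hx y hy t
  obtain ⟨G, hG⟩ := cauchySeq_tendsto_of_complete hcs
  have hGt : ∀ t, Filter.Tendsto (fun n => Φ n x y t) Filter.atTop (nhds (G t)) := fun t =>
    ((continuous_eval_const t).tendsto G).comp hG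
  have hG0 : G 0 = x := tendsto_nhds_unique (hGt 0) (by simp)
  have hG1 : G 1 = y := tendsto_nhds_unique (hGt 1) (by simp)
  refine ⟨⟨G, hG0, hG1⟩, fun t => ?_⟩
  change G t ∈ K
  choose z hz hzd using fun n => hnear n x hx y hy t
  have hlim : Filter.Tendsto (fun n => 2 * M * r ^ n) Filter.atTop (nhds 0) := by
    simpa using (tendsto_pow_atTop_nhds_zero_of_lt_one hr0 hr1).const_mul (2 * M)
  have hd : Filter.Tendsto (fun n => dist (Φ n x y t) (z n)) Filter.atTop (nhds 0) :=
    squeeze_zero (fun _ => dist_nonneg) hzd hlim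
  have hzl : Filter.Tendsto z Filter.atTop (nhds (G t)) :=
    (hGt t).congr_dist hd
  exact hK.2.1.isClosed.mem_of_tendsto hzl (Filter.Eventually.of_forall hz)

end attractor

/-! ### Perturbations of triods -/

theorem mem_slitPlane_div {a b c : ℂ} {η : ℝ} (hη : 0 < η) (h : η ≤ ‖a - b‖) (hc : ‖c - b‖ < η) :
    (a - c) / (a - b) ∈ Complex.slitPlane := by
  have hab : 0 < ‖a - b‖ := hη.trans_le h
  have hab' : a - b ≠ 0 := norm_pos_iff.1 hab
  apply Complex.ball_one_subset_slitPlane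
  rw [mem_ball_iff_norm, div_sub_one hab', norm_div, div_lt_one hab, sub_sub_sub_cancel_left,
    norm_sub_rev]
  exact hc.trans_le h

/-- Two continuous logarithms on the line of functions with the ratio `q`, where `q` avoids the
negative half-line, have increments which differ by the increment of `log q`. -/
theorem log_increment {f g : ℝ → ℂ} (hf : Continuous f) (hg : Continuous g) {q : ℝ → ℂ}
    (hq : Continuous q) (hqs : ∀ t, q t ∈ Complex.slitPlane)
    (h : ∀ t, Complex.exp (f t) = q t * Complex.exp (g t)) :
    f 1 - f 0 = g 1 - g 0 + Complex.log (q 1) - Complex.log (q 0) := by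
  have hlq : Continuous fun t => Complex.log (q t) :=
    continuous_iff_continuousAt.2 fun t => hq.continuousAt.clog (hqs t)
  have key : f = fun t => g t + Complex.log (q t) + (f 0 - g 0 - Complex.log (q 0)) := by
    refine log_unique hf (by fun_prop) (fun t => ?_) 0 (by ring)
    rw [Complex.exp_add, Complex.exp_add, Complex.exp_sub, Complex.exp_sub, h, h,
      Complex.exp_log (Complex.slitPlane_ne_zero (hqs t)),
      Complex.exp_log (Complex.slitPlane_ne_zero (hqs 0))]
    have h1 := Complex.slitPlane_ne_zero (hqs 0)
    have h2 := Complex.exp_ne_zero (g 0)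
    field_simp
  have := congrFun key 1
  linear_combination this

/-- A triod in the plane, with legs `γ i`, meets each of its small perturbations. -/
theorem triod_inter_perturbation {γ : Fin 3 → ℝ → ℂ} (hγ : ∀ i, Continuous (γ i)) {A : ℂ}
    (hA : ∀ i, γ i 1 = A) {η : ℝ} (hη : 0 < η)
    (hsep : ∀ i j, i ≠ j → ∀ s, η ≤ ‖γ i s - γ j 0‖) {h : ℂ → ℂ} (hh : Continuous h)
    (hclose : ∀ i s, ‖h (γ i s) - γ i s‖ < η) :
    ∃ i j s t, γ i s = h (γ j t) := by
  by_contra! hne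
  -- If the triod missed its perturbation, `log (x - h y)` would be defined for all `x`, `y` on the
  -- triod. The common value at the centre `(1, 1)` makes the nine branches fit together.
  have hlog : ∀ i j, ∃ L : ℝ × ℝ → ℂ, Continuous L ∧ L (1, 1) = Complex.log (A - h A) ∧
      ∀ q, Complex.exp (L q) = γ i q.1 - h (γ j q.2) := by
    intro i j
    refine exists_continuous_log (g := fun q : ℝ × ℝ => γ i q.1 - h (γ j q.2)) ?_
      (fun q => sub_ne_zero.2 (hne i j q.1 q.2)) (1, 1) _ ?_
    · have := hγ i
      have := hγ j
      fun_prop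
    · simp only [hA]
      rw [Complex.exp_log]
      have := hne i j 1 1
      rw [hA, hA] at this
      exact sub_ne_zero.2 this
  choose L hLc hL1 hL using hlog
  have hleft : ∀ i i' j t, L i j (1, t) = L i' j (1, t) := by
    intro i i' j t
    have := log_unique (f := fun t : ℝ => L i j (1, t)) (g := fun t : ℝ => L i' j (1, t))
      ((hLc i j).comp (by fun_prop)) ((hLc i' j).comp (by fun_prop))
      (fun t => by simp only [hL, hA]) 1 (by simp only [hL1])
    exact congrFun this t
  have hright : ∀ i j j' s, L i j (s, 1) = L i j' (s, 1) := by
    intro i j j' s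
    have := log_unique (f := fun s : ℝ => L i j (s, 1)) (g := fun s : ℝ => L i j' (s, 1))
      ((hLc i j).comp (by fun_prop)) ((hLc i j').comp (by fun_prop))
      (fun s => by simp only [hL, hA]) 1 (by simp only [hL1])
    exact congrFun this s
  have hlog' : ∀ i j, ∃ l : ℝ → ℂ, i ≠ j → Continuous l ∧
      ∀ s, Complex.exp (l s) = γ i s - γ j 0 := by
    intro i j
    by_cases hij : i = j
    · exact ⟨0, fun h => absurd hij h⟩
    have h0 : ∀ s, γ i s - γ j 0 ≠ 0 := fun s => norm_pos_iff.1 (hη.trans_le (hsep i j hij s))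
    obtain ⟨l, hl, -, hl'⟩ := exists_continuous_log (g := fun s => γ i s - γ j 0)
      ((hγ i).sub continuous_const) h0 0 _ (Complex.exp_log (h0 0))
    exact ⟨l, fun _ => ⟨hl, hl'⟩⟩
  choose l hl using hlog'
  set lg : ℂ → ℂ → ℂ := fun a b => Complex.log ((a - h b) / (a - b)) with hlg
  have move₁ : ∀ i j, i ≠ j → L i j (1, 0) - L i j (0, 0) =
      l i j 1 - l i j 0 + lg A (γ j 0) - lg (γ i 0) (γ j 0) := by
    intro i j hij
    obtain ⟨hlc, hle⟩ := hl i j hij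
    have h0 : ∀ s, γ i s - γ j 0 ≠ 0 := fun s => norm_pos_iff.1 (hη.trans_le (hsep i j hij s))
    have := log_increment (f := fun s : ℝ => L i j (s, 0)) (g := l i j)
      (q := fun s => (γ i s - h (γ j 0)) / (γ i s - γ j 0)) ((hLc i j).comp (by fun_prop)) hlc
      (((hγ i).sub continuous_const).div ((hγ i).sub continuous_const) h0)
      (fun s => mem_slitPlane_div hη (hsep i j hij s) (hclose j 0))
      (fun s => by rw [hL, hle, div_mul_cancel₀ _ (h0 s)])
    simpa only [hA] using this
  -- Now the second point moves. The difference changes sign relative to `l i j`, hence the shift by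
  -- `πi`, which drops out of the increment.
  have move₂ : ∀ i j, i ≠ j → L j i (0, 1) - L j i (0, 0) =
      l i j 1 - l i j 0 + lg (γ j 0) A - lg (γ j 0) (γ i 0) := by
    intro i j hij
    obtain ⟨hlc, hle⟩ := hl i j hij
    have h0 : ∀ s, γ j 0 - γ i s ≠ 0 := fun s => by
      rw [← norm_pos_iff, norm_sub_rev]
      exact hη.trans_le (hsep i j hij s)
    have := log_increment (f := fun s : ℝ => L j i (0, s))
      (g := fun s => l i j s + Real.pi * Complex.I)
      (q := fun s => (γ j 0 - h (γ i s)) / (γ j 0 - γ i s)) ((hLc j i).comp (by fun_prop))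
      (by fun_prop)
      ((continuous_const.sub (hh.comp (hγ i))).div (continuous_const.sub (hγ i)) h0)
      (fun s => mem_slitPlane_div hη (by rw [norm_sub_rev]; exact hsep i j hij s) (hclose i s))
      (fun s => by
        rw [hL, Complex.exp_add, Complex.exp_pi_mul_I, hle, mul_neg_one, neg_sub,
          div_mul_cancel₀ _ (h0 s)])
    simp only [hA] at this
    linear_combination this
  -- Two points standing at the ends of legs 0 and 1 change places through the triod, one moving at
  -- a time while the other waits at an end. `W` is the total increment of the logarithm of their
  -- difference.
  set W : ℂ := (l 0 1 1 - l 0 1 0) - (l 2 1 1 - l 2 1 0) + (l 1 2 1 - l 1 2 0) -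
    (l 0 2 1 - l 0 2 0) + (l 2 0 1 - l 2 0 0) - (l 1 0 1 - l 1 0 0) with hW
  -- Exchanging twice is a closed tour of twelve moves. The single-valued `L` has total increment 0
  -- and the corrections `lg` telescope, so `2 W = 0`.
  have hW0 : W = 0 := by
    have a₁ := move₁ 0 1 (by decide)
    have a₂ := move₁ 2 1 (by decide)
    have a₃ := move₂ 1 2 (by decide)
    have a₄ := move₂ 0 2 (by decide)
    have a₅ := move₁ 2 0 (by decide)
    have a₆ := move₁ 1 0 (by decide)
    have b₁ := move₂ 0 1 (by decide)
    have b₂ := move₂ 2 1 (by decide)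
    have b₃ := move₁ 1 2 (by decide)
    have b₄ := move₁ 0 2 (by decide)
    have b₅ := move₂ 2 0 (by decide)
    have b₆ := move₂ 1 0 (by decide)
    have c₁ := hleft 0 2 1 0
    have c₂ := hright 2 1 0 0
    have c₃ := hleft 2 1 0 0
    have c₄ := hright 1 0 2 0
    have c₅ := hleft 1 0 2 0
    have c₆ := hright 0 2 1 0
    linear_combination (1 / 2 : ℂ) * (c₁ + c₂ + c₃ + c₄ + c₅ + c₆ -
      (a₁ - a₂ + a₃ - a₄ + a₅ - a₆ + b₁ - b₂ + b₃ - b₄ + b₅ - b₆)) + hW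
  -- One exchange reverses the difference of the two points.
  have hWe : Complex.exp W = -1 := by
    have e : ∀ i j, i ≠ j → ∀ s, Complex.exp (l i j s) = γ i s - γ j 0 := fun i j hij =>
      (hl i j hij).2
    have h0 : ∀ i j, i ≠ j → ∀ s, γ i s - γ j 0 ≠ 0 := fun i j hij s =>
      norm_pos_iff.1 (hη.trans_le (hsep i j hij s))
    have n₁ := h0 0 1 (by decide) 0
    have n₂ := h0 1 2 (by decide) 0
    have n₃ := h0 2 0 (by decide) 0
    have n₁' := h0 1 0 (by decide) 0
    have n₂' := h0 2 1 (by decide) 0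
    have n₃' := h0 0 2 (by decide) 0
    have m₁ := h0 0 1 (by decide) 1
    have m₂ := h0 1 2 (by decide) 1
    have m₃ := h0 2 0 (by decide) 1
    rw [hA] at m₁ m₂ m₃
    simp only [hW, Complex.exp_add, Complex.exp_sub]
    rw [e 0 1 (by decide), e 0 1 (by decide), e 2 1 (by decide), e 2 1 (by decide),
      e 1 2 (by decide), e 1 2 (by decide), e 0 2 (by decide), e 0 2 (by decide),
      e 2 0 (by decide), e 2 0 (by decide), e 1 0 (by decide), e 1 0 (by decide)]
    simp only [hA]
    field_simp
    ring
  rw [hW0, Complex.exp_zero] at hWe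
  norm_num at hWe

/-! ### Existence of parameters -/

theorem joinedIn_map {X Y : Type*} [TopologicalSpace X] [TopologicalSpace Y] {F : Set X}
    {G : Set Y} {x y : X} (h : JoinedIn F x y) {f : X → Y} (hf : Continuous f) (hFG : MapsTo f F G) :
    JoinedIn G (f x) (f y) := by
  obtain ⟨p, hp⟩ := h
  exact ⟨p.map hf, fun t => hFG (hp t)⟩

/-- A path to `A ≠ x` can be chosen to reach `A` only at its end. -/
theorem exists_path_first_hit {K : Set ℂ} {x A : ℂ} (h : JoinedIn K x A) (hne : x ≠ A) :
    ∃ γ : ℝ → ℂ, Continuous γ ∧ γ 0 = x ∧ γ 1 = A ∧ (∀ s, γ s ∈ K) ∧ (∀ s < 1, γ s ≠ A) ∧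
      ∀ s, ∃ s' ∈ Icc (0 : ℝ) 1, γ s' = γ s := by
  obtain ⟨p, hp⟩ := h
  have hc : Continuous fun t => p.extend t := p.extend.continuous
  have hcl : IsCompact (Icc (0 : ℝ) 1 ∩ {t | p.extend t = A}) :=
    isCompact_Icc.inter_right (isClosed_eq hc continuous_const)
  obtain ⟨t₀, ⟨ht₀, ht₀A⟩, hmin⟩ := hcl.exists_isLeast ⟨1, by simp, p.extend_one⟩
  have ht₀A' : p.extend t₀ = A := ht₀A
  have ht₀p : 0 < t₀ := by
    refine lt_of_le_of_ne ht₀.1 fun h => hne ?_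
    rw [← ht₀A', ← h, p.extend_zero]
  have hcl : ∀ s : ℝ, max 0 (min 1 s) ∈ Icc (0 : ℝ) 1 := fun s =>
    ⟨le_max_left _ _, max_le zero_le_one (min_le_left _ _)⟩
  -- Clamping `s` to `[0, 1]` defines the leg on the whole line without adding points.
  refine ⟨fun s => p.extend (t₀ * max 0 (min 1 s)), hc.comp (by fun_prop), ?_, ?_, fun s => hp _, ?_,
    fun s => ⟨max 0 (min 1 s), hcl s, ?_⟩⟩
  · simp
  · simpa using ht₀A'
  · intro s hs h
    have h1 : max 0 (min 1 s) < 1 := max_lt one_pos (min_lt_of_right_lt hs)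
    have h2 : t₀ * max 0 (min 1 s) < t₀ := by nlinarith
    have h3 := (hcl s).1
    exact absurd (hmin ⟨⟨by positivity, h2.le.trans ht₀.2⟩, h⟩) (not_le.2 h2)
  · simp only [min_eq_right (hcl s).2, max_eq_right (hcl s).1]

section attractor

variable {m : ℕ} {S : Fin m → ContractingSimilarity} {K : Set ℂ}

/-- Pieces of a prescribed size around a point of the attractor. -/
theorem IsAttractor.exists_word (hK : IsAttractor S K) {r₀ : ℝ} (hr₀ : 0 < r₀) (hr₀1 : r₀ ≤ 1)
    (hmin : ∀ k, r₀ ≤ ‖(S k).mult‖) {σ : ℝ} (hσ : 0 < σ) (hσ1 : σ ≤ 1) {p : ℂ} (hp : p ∈ K) :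
    ∃ u : List (Fin m), p ∈ wordMap S u '' K ∧ r₀ * σ ≤ ‖wordMult S u‖ ∧ ‖wordMult S u‖ ≤ σ := by
  obtain ⟨r, hr0, hr1, hr⟩ := exists_ratio_bound S
  have key : ∀ n : ℕ, ∀ p ∈ K, ∀ σ : ℝ, 0 < σ → σ ≤ 1 → r ^ n ≤ σ → ∃ u : List (Fin m),
      p ∈ wordMap S u '' K ∧ r₀ * σ ≤ ‖wordMult S u‖ ∧ ‖wordMult S u‖ ≤ σ := by
    intro n
    induction n with
    | zero =>
      intro p hp σ hσ hσ1 hn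
      rw [pow_zero] at hn
      obtain rfl := le_antisymm hσ1 hn
      exact ⟨[], ⟨p, hp, rfl⟩, by simpa using hr₀1, by simp⟩
    | succ n ih =>
      intro p hp σ hσ hσ1 hn
      rw [hK.2.2] at hp
      obtain ⟨k, p', hp', rfl⟩ := mem_iUnion.1 hp
      have hk0 : 0 < ‖(S k).mult‖ := norm_pos_iff.2 (S k).mult_ne_zero
      rcases le_total (σ / ‖(S k).mult‖) 1 with h | h
      · obtain ⟨u, ⟨z, hz, hz'⟩, h1, h2⟩ := ih p' hp' (σ / ‖(S k).mult‖) (by positivity) h (by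
          rw [le_div_iff₀ hk0]
          refine le_trans ?_ hn
          rw [pow_succ]
          gcongr
          exact hr k)
        refine ⟨k :: u, ⟨z, hz, ?_⟩, ?_, ?_⟩
        · simp only [wordMap, hz']
        · rw [wordMult_cons, norm_mul, mul_comm ‖(S k).mult‖]
          rwa [← mul_div_assoc, div_le_iff₀ hk0] at h1
        · rw [wordMult_cons, norm_mul, mul_comm ‖(S k).mult‖]
          rwa [le_div_iff₀ hk0] at h2
      · rw [le_div_iff₀ hk0, one_mul] at h
        refine ⟨[k], ⟨p', hp', rfl⟩, ?_, ?_⟩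
        · rw [wordMult_cons, wordMult_nil, mul_one]
          exact (mul_le_of_le_one_right hr₀.le hσ1).trans (hmin k)
        · simpa using h
  obtain ⟨n, hn⟩ := exists_pow_lt_of_lt_one hσ hr1
  exact key n p hp σ hσ hσ1 hn.le

/-- Among sufficiently many points of a ball two are close to each other. -/
theorem exists_close_pair {E : Type*} [PseudoMetricSpace E] [ProperSpace E] (x₀ : E) (C : ℝ) {ε : ℝ}
    (hε : 0 < ε) : ∃ N : ℕ, ∀ a : Fin (N + 1) → E, (∀ n, dist (a n) x₀ ≤ C) →
      ∃ n n', n ≠ n' ∧ dist (a n) (a n') < ε := by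
  obtain ⟨t, htf, hcov⟩ := Metric.totallyBounded_iff.1
    (isCompact_closedBall x₀ C).totallyBounded (ε / 2) (by positivity)
  have := htf.fintype
  refine ⟨Fintype.card t, fun a ha => ?_⟩
  have hex : ∀ n, ∃ y : t, dist (a n) y < ε / 2 := fun n => by
    obtain ⟨y, hy, h⟩ := mem_iUnion₂.1 (hcov (Metric.mem_closedBall.2 (ha n)))
    exact ⟨⟨y, hy⟩, h⟩
  choose y hy using hex
  obtain ⟨n, n', hne, h⟩ := Fintype.exists_ne_map_eq_of_card_lt y (by simp)
  refine ⟨n, n', hne, (dist_triangle_right _ _ (y n : E)).trans_lt ?_⟩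
  have h2 := hy n'
  rw [← h] at h2
  linarith [hy n]

/-- Let `S_w` fix the point `A` of a connected attractor `K`. Then two points of each orbit of `S_w`
are joined by a path in `K \ {A}`. -/
theorem IsAttractor.exists_joinedIn_iterate (hK : IsAttractor S K) (hc : IsConnected K)
    {w : List (Fin m)} (hw : w ≠ []) {A : ℂ} (hA : wordMap S w A = A) {x : ℂ} (hx : x ∈ K)
    (hxA : x ≠ A) : ∃ i j : ℕ, i < j ∧
      JoinedIn (K \ {A}) ((wordMap S w)^[i] x) ((wordMap S w)^[j] x) := by
  by_contra! hno
  set T : ℂ → ℂ := wordMap S w with hT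
  have hno' : ∀ i j : ℕ, i ≠ j → ¬ JoinedIn (K \ {A}) (T^[i] x) (T^[j] x) := by
    intro i j hij h
    rcases lt_or_gt_of_ne hij with h' | h'
    · exact hno i j h' h
    · exact hno j i h' h.symm
  have hAK : A ∈ K := hK.fixed_mem hw hA
  have hTc : ∀ n, Continuous T^[n] := (continuous_wordMap S w).iterate
  have hTA : ∀ n, T^[n] A = A := fun n => Function.iterate_fixed hA n
  have hTne : ∀ n z, z ≠ A → T^[n] z ≠ A := fun n z hz h =>
    hz ((wordMap_injective S w).iterate n (h.trans (hTA n).symm))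
  obtain ⟨γ, hγc, hγ0, hγ1, hγK, hγA, hγcl⟩ := exists_path_first_hit (hK.joinedIn hc hx hAK) hxA
  have hjoin : ∀ n, ∀ s < 1, JoinedIn (K \ {A}) (T^[n] x) (T^[n] (γ s)) := by
    intro n s hs
    refine JoinedIn.ofLine (f := fun r => T^[n] (γ (r * s)))
      ((hTc n).comp (hγc.comp (by fun_prop))).continuousOn (by simp [hγ0]) (by simp) ?_
    rintro _ ⟨r, hr, rfl⟩
    refine ⟨hK.iterate_mem w (hγK _) n, hTne n _ (hγA _ ?_)⟩
    rcases le_total 0 s with h | h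
    · exact (mul_le_of_le_one_left h hr.2).trans_lt hs
    · exact (mul_nonpos_of_nonneg_of_nonpos hr.1 h).trans_lt one_pos
  have hlt : ∀ n s, T^[n] (γ s) ≠ A → ∃ s' < 1, γ s' = γ s := by
    intro n s h
    obtain ⟨s', hs', he⟩ := hγcl s
    refine ⟨s', lt_of_le_of_ne hs'.2 fun h1 => h ?_, he⟩
    rw [← he, h1, hγ1, hTA]
  have hdisj : ∀ i j, i ≠ j → ∀ s, T^[i] (γ s) ≠ T^[j] (γ 0) := by
    intro i j hij s h
    have hneA : T^[i] (γ s) ≠ A := by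
      rw [h, hγ0]
      exact hTne j x hxA
    obtain ⟨s', hs', he⟩ := hlt i s hneA
    have := hjoin i s' hs'
    rw [he, h, hγ0] at this
    exact hno' i j hij this
  -- The legs from `x`, `T x` and `T² x` to `A` form a triod in `K`. Each leg stays away from the
  -- outer ends of the others, as these lie in other path components of `K \ {A}`.
  obtain ⟨η, hη, hclose⟩ : ∃ η > 0, ∀ h : ℂ → ℂ, Continuous h → (∀ z ∈ K, ‖h z - z‖ < η) →
      ∃ z ∈ K, h z ∈ K := by
    have hex : ∀ q : Fin 3 × Fin 3, ∃ η > 0, q.1 ≠ q.2 →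
        ∀ s, η ≤ ‖T^[q.1] (γ s) - T^[q.2] (γ 0)‖ := by
      rintro ⟨i, j⟩
      by_cases hij : i = j
      · exact ⟨1, one_pos, fun h => absurd hij h⟩
      have hcont : Continuous fun s => ‖T^[(i : ℕ)] (γ s) - T^[(j : ℕ)] (γ 0)‖ :=
        (((hTc i).comp hγc).sub continuous_const).norm
      obtain ⟨s₀, -, hs₀⟩ := (isCompact_Icc (a := (0 : ℝ)) (b := 1)).exists_isMinOn
        ⟨0, by simp⟩ hcont.continuousOn
      refine ⟨_, norm_pos_iff.2 (sub_ne_zero.2 (hdisj i j (fun h => hij (Fin.ext h)) s₀)),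
        fun _ s => ?_⟩
      obtain ⟨s', hs', he⟩ := hγcl s
      simp only
      rw [← he]
      exact hs₀ hs'
    choose η hη0 hη using hex
    refine ⟨Finset.univ.inf' Finset.univ_nonempty η, (Finset.lt_inf'_iff _).2 fun q _ => hη0 q,
      fun h hh hcl => ?_⟩
    obtain ⟨i, j, s, t, he⟩ := triod_inter_perturbation
      (γ := fun (i : Fin 3) s => T^[(i : ℕ)] (γ s)) (fun i => (hTc i).comp hγc) (A := A)
      (fun i => by rw [hγ1, hTA]) ((Finset.lt_inf'_iff _).2 fun q _ => hη0 q)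
      (fun i j hij s => (Finset.inf'_le η (Finset.mem_univ (i, j))).trans (hη (i, j) hij s)) hh
      (fun i s => hcl _ (hK.iterate_mem w (hγK s) i))
    refine ⟨_, hK.iterate_mem w (hγK t) j, ?_⟩
    rw [← he]
    exact hK.iterate_mem w (hγK s) i
  obtain ⟨r₀, hr₀, hr₀1, hr₀S⟩ : ∃ r₀ : ℝ, 0 < r₀ ∧ r₀ ≤ 1 ∧ ∀ k, r₀ ≤ ‖(S k).mult‖ := by
    have : Nonempty (Fin m) := by
      cases w with
      | nil => exact absurd rfl hw
      | cons k _ => exact ⟨k⟩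
    refine ⟨Finset.univ.inf' Finset.univ_nonempty fun k => ‖(S k).mult‖,
      (Finset.lt_inf'_iff _).2 fun k _ => norm_pos_iff.2 (S k).mult_ne_zero, ?_,
      fun k => Finset.inf'_le _ (Finset.mem_univ k)⟩
    exact (Finset.inf'_le _ (Finset.mem_univ this.some)).trans (S _).norm_mult_lt_one.le
  obtain ⟨D, hD⟩ := Metric.isBounded_iff.1 hK.2.1.isBounded
  have hxAD : ‖x - A‖ ≤ D := by simpa [dist_eq_norm] using hD hx hAK
  have hxA0 : 0 < ‖x - A‖ := norm_pos_iff.2 (sub_ne_zero.2 hxA)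
  have hD0 : 0 < D := hxA0.trans_le hxAD
  obtain ⟨N, hN⟩ := exists_close_pair (0 : ℂ × ℂ) (max 1 (4 * D))
    (show 0 < r₀ * η / (2 * (D + 1)) by positivity)
  set μ := ‖wordMult S w‖ with hμ
  have hμ0 : 0 < μ := norm_pos_iff.2 (wordMult_ne_zero S w)
  have hμ1 : μ ≤ 1 := norm_wordMult_le_one S w
  -- This is the distance from `A` to `T^N x`, so the legs with `n ≤ N` all cross the circle of
  -- radius `ρ`. A piece of ratio at most `σ` has diameter at most `ρ / 2`; around such a crossing
  -- it misses `A` and stays in the path component of its leg.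
  set ρ := μ ^ N * ‖x - A‖ with hρ
  have hρ0 : 0 < ρ := by positivity
  have hρx : ρ ≤ ‖x - A‖ := mul_le_of_le_one_left hxA0.le (pow_le_one₀ hμ0.le hμ1)
  set σ := ρ / (2 * D) with hσ
  have hσ0 : 0 < σ := by positivity
  have hσ1 : σ ≤ 1 := by
    rw [hσ, div_le_one (by positivity)]
    linarith
  have hσD : σ * D = ρ / 2 := by
    rw [hσ]
    field_simp
  have hpiece : ∀ n : Fin (N + 1), ∃ u : List (Fin m), r₀ * σ ≤ ‖wordMult S u‖ ∧
      ‖wordMult S u‖ ≤ σ ∧ ‖wordMap S u A - A‖ ≤ 2 * ρ ∧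
      ∀ z ∈ K, JoinedIn (K \ {A}) (T^[(n : ℕ)] x) (wordMap S u z) := by
    intro n
    have hcont : Continuous fun s => ‖T^[(n : ℕ)] (γ s) - A‖ :=
      (((hTc n).comp hγc).sub continuous_const).norm
    obtain ⟨s, hs, hsρ⟩ := intermediate_value_Icc' zero_le_one hcont.continuousOn
      (show ρ ∈ Icc (‖T^[(n : ℕ)] (γ 1) - A‖) ‖T^[(n : ℕ)] (γ 0) - A‖ by
        rw [hγ1, hγ0, hTA, sub_self, norm_zero, iterate_sub_of_fixed hA, norm_mul, norm_pow]
        refine ⟨hρ0.le, ?_⟩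
        gcongr ?_ * _
        exact pow_le_pow_of_le_one hμ0.le hμ1 (Nat.lt_succ_iff.1 n.2))
    simp only at hsρ
    have hs1 : s < 1 := lt_of_le_of_ne hs.2 fun h => by
      rw [h, hγ1, hTA, sub_self, norm_zero] at hsρ
      exact hρ0.ne hsρ
    obtain ⟨u, ⟨z₀, hz₀, hz₀'⟩, h1, h2⟩ := hK.exists_word hr₀ hr₀1 hr₀S hσ0 hσ1
      (hK.iterate_mem w (hγK s) n)
    have hdiam : ∀ z ∈ K, ‖wordMap S u z - T^[(n : ℕ)] (γ s)‖ ≤ ρ / 2 := by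
      intro z hz
      rw [← hz₀', wordMap_sub, norm_mul, ← hσD]
      gcongr
      simpa [dist_eq_norm] using hD hz hz₀
    refine ⟨u, h1, h2, ?_, fun z hz => ?_⟩
    · calc ‖wordMap S u A - A‖
          ≤ ‖wordMap S u A - T^[(n : ℕ)] (γ s)‖ + ‖T^[(n : ℕ)] (γ s) - A‖ :=
            norm_sub_le_norm_sub_add_norm_sub _ _ _
        _ ≤ 2 * ρ := by linarith [hdiam A hAK]
    · refine (hjoin n s hs1).trans ?_
      rw [← hz₀']
      refine joinedIn_map (hK.joinedIn hc hz₀ hz) (continuous_wordMap S u) ?_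
      intro z' hz'
      refine ⟨hK.wordMap_mem u hz', fun h => ?_⟩
      have h3 := hdiam z' hz'
      rw [mem_singleton_iff.1 h, norm_sub_rev, hsρ] at h3
      linarith
  choose u hu₁ hu₂ hu₃ hu₄ using hpiece
  -- The pieces are compared after rescaling by `σ`. The bound `4 * D` is `2 * ρ / σ`.
  obtain ⟨n, n', hnn, hdist⟩ := hN
    (fun n => (wordMult S (u n) / σ, (wordMap S (u n) A - A) / σ)) (fun n => by
      have hσn : ‖(σ : ℂ)‖ = σ := by
        rw [Complex.norm_real, Real.norm_eq_abs, abs_of_pos hσ0]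
      rw [dist_zero_right, Prod.norm_mk, norm_div, norm_div, hσn]
      refine max_le_max ?_ ?_
      · rw [div_le_one hσ0]
        exact hu₂ n
      · rw [div_le_iff₀ hσ0]
        linarith [hu₃ n])
  have hdisjoint : ∀ z ∈ K, ∀ z' ∈ K, wordMap S (u n) z ≠ wordMap S (u n') z' := by
    intro z hz z' hz' h
    have h1 := hu₄ n z hz
    rw [h] at h1
    exact hno' n n' (fun h => hnn (Fin.ext h)) (h1.trans (hu₄ n' z' hz').symm)
  have hμn : wordMult S (u n) ≠ 0 := wordMult_ne_zero S _
  -- This is `S_{u n}⁻¹ ∘ S_{u n'}`. It is `η`-close to the identity on `K`, so the two pieces must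
  -- intersect.
  set h : ℂ → ℂ := fun z => (wordMap S (u n') z - wordMap S (u n) A) / wordMult S (u n) + A with hh
  have hhc : Continuous h := by
    have := continuous_wordMap S (u n')
    fun_prop
  have hhS : ∀ z, wordMap S (u n) (h z) = wordMap S (u n') z := by
    intro z
    rw [wordMap_eq S (u n) _ A]
    simp only [hh]
    field_simp
    ring
  obtain ⟨z, hz, hhz⟩ := hclose h hhc (fun z hz => by
    have hσc : (σ : ℂ) ≠ 0 := by exact_mod_cast hσ0.ne'
    have hσn : ‖(σ : ℂ)‖ = σ := by
      rw [Complex.norm_real, Real.norm_eq_abs, abs_of_pos hσ0]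
    rw [dist_comm, Prod.dist_eq, max_lt_iff, dist_eq_norm, dist_eq_norm, ← sub_div, ← sub_div,
      norm_div, norm_div, hσn, div_lt_iff₀ hσ0, div_lt_iff₀ hσ0, sub_sub_sub_cancel_right] at hdist
    have e : h z - z = ((wordMult S (u n') - wordMult S (u n)) * (z - A) +
        (wordMap S (u n') A - wordMap S (u n) A)) / wordMult S (u n) := by
      simp only [hh]
      rw [wordMap_eq S (u n') z A]
      field_simp
      ring
    have hzA : ‖z - A‖ ≤ D := by simpa [dist_eq_norm] using hD hz hAK
    rw [e, norm_div, div_lt_iff₀ (norm_pos_iff.2 hμn)]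
    set κ := r₀ * η / (2 * (D + 1)) * σ with hκ
    have hκD : κ * (D + 1) = η * (r₀ * σ) / 2 := by
      rw [hκ]
      field_simp
    calc _ ≤ ‖wordMult S (u n') - wordMult S (u n)‖ * ‖z - A‖ +
          ‖wordMap S (u n') A - wordMap S (u n) A‖ :=
          (norm_add_le _ _).trans (by rw [norm_mul])
      _ ≤ κ * D + κ := by
        gcongr
        · exact hdist.1.le
        · exact hdist.2.le
      _ = η * (r₀ * σ) / 2 := by rw [← hκD]; ring
      _ < η * (r₀ * σ) := half_lt_self (by positivity)
      _ ≤ η * ‖wordMult S (u n)‖ := by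
        gcongr
        exact hu₁ n)
  exact hdisjoint (h z) hhz z hz (hhS z)

/-- A fixed point of `S_w` in a connected attractor with more than one point has a parameter. -/
theorem IsAttractor.exists_isParameter (hK : IsAttractor S K) (hc : IsConnected K)
    {w : List (Fin m)} (hw : w ≠ []) {A : ℂ} (hA : wordMap S w A = A) {x : ℂ} (hx : x ∈ K)
    (hxA : x ≠ A) : ∃ lam, IsParameter S K A lam := by
  obtain ⟨i, j, hij, hJ⟩ := hK.exists_joinedIn_iterate hc hw hA hx hxA
  set y := (wordMap S w)^[i] x
  obtain ⟨p, hp⟩ := hJ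
  -- The power `w^(j - i)` carries `T^i x` to `T^j x`, so the path found joins a point to its image
  -- under one word.
  set W := (List.replicate (j - i) w).flatten with hW
  have hWm : wordMap S W = (wordMap S w)^[j - i] := wordMap_flatten_replicate S w _
  have hWA : wordMap S W A = A := by
    rw [hWm]
    exact Function.iterate_fixed hA _
  have hWy : wordMap S W y = (wordMap S w)^[j] x := by
    rw [hWm, ← Function.iterate_add_apply, Nat.sub_add_cancel hij.le]
  have hWne : W ≠ [] := by
    obtain ⟨k, hk⟩ : ∃ k, j - i = k + 1 := ⟨j - i - 1, by omega⟩
    rw [hW, hk, List.replicate_succ, List.flatten_cons]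
    exact List.append_ne_nil_of_left_ne_nil hw _
  have hmem : ∀ t, p.extend t ∈ K \ {A} := fun t => hp _
  have hne : ∀ t, p.extend t - A ≠ 0 := fun t => sub_ne_zero.2 (hmem t).2
  obtain ⟨g, hg, -, hge⟩ := exists_continuous_log (g := fun t => p.extend t - A)
    (p.extend.continuous.sub continuous_const) hne 0 _ (Complex.exp_log (hne 0))
  have hmult : wordMult S W = Complex.exp (g 1 - g 0) := by
    have h1 := wordMap_sub S W y A
    rw [hWA, hWy] at h1
    have h0 : y - A ≠ 0 := by simpa using hne 0
    rw [Complex.exp_sub, hge, hge, p.extend_one, p.extend_zero, h1, mul_div_cancel_right₀ _ h0]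
  refine ⟨_, W, Real.exp ((g 1).re - (g 0).re), (g 1).im - (g 0).im, hWne, Real.exp_pos _,
    fun z => ?_, ⟨y, fun t => p.extend t, fun t => (g t).im, p.extend.continuous.continuousOn,
      (Complex.continuous_im.comp hg).continuousOn, fun t _ => hmem t, fun t _ => ?_, p.extend_zero,
      by rw [hWy]; exact p.extend_one, rfl⟩, rfl⟩
  · rw [wordMap_eq S W z A, hWA, hmult, Complex.ofReal_exp, ← Complex.exp_add]
    congr 3
    apply Complex.ext <;> simp
  · rw [← hge, Complex.norm_exp, Complex.ofReal_exp, ← Complex.exp_add, Complex.re_add_im]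

/-- The attractor of a generalized polygonal system is not a single point. -/
theorem IsGeneralizedPolygonalSystem.exists_ne {n : ℕ} {P : Polygon ℂ n}
    (hS : IsGeneralizedPolygonalSystem P S) (hK : IsAttractor S K) (A : ℂ) : ∃ x ∈ K, x ≠ A := by
  by_contra! hall
  obtain ⟨z, hz⟩ := hK.1
  obtain rfl := hall z hz
  have hfix : ∀ k, S k z = z := fun k => hall _ (hK.map_mem k hz)
  obtain ⟨hn, hinj, -⟩ := hS.simple
  have : Nonempty (Fin n) := ⟨⟨0, by omega⟩⟩
  -- If all maps fixed `z`, a vertex farthest from `z` would be a contracted image of another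
  -- vertex, forcing all vertices to coincide with `z`.
  obtain ⟨i, hi⟩ := Finite.exists_max fun i => dist (P.vertices i) z
  obtain ⟨k, -, ⟨i', rfl⟩, hi'⟩ := mem_iUnion.1 (hS.vertices_subset (mem_range_self i))
  have h1 : dist (P.vertices i) z = ‖(S k).mult‖ * dist (P.vertices i') z := by
    rw [← hi', ← ContractingSimilarity.dist_map, hfix]
  have h2 : dist (P.vertices i) z = 0 := by
    have h3 := (S k).norm_mult_lt_one
    have h4 := hi i'
    have h5 := mul_le_mul_of_nonneg_left h4 (norm_nonneg (S k).mult)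
    have h6 : 0 ≤ dist (P.vertices i) z := dist_nonneg
    nlinarith
  have h6 : ∀ l, P.vertices l = z := fun l =>
    dist_le_zero.1 ((hi l).trans h2.le)
  have := hinj ((h6 ⟨0, by omega⟩).trans (h6 ⟨1, by omega⟩).symm)
  simp at this

end attractor

end PolygonalSystem

/-- The parameter matching condition holds for every connected attractor without simple closed
curves: two curves spiralling towards the same point at different rates would cross infinitely
often and so enclose the point, and infinitely many disjoint images of a triod under similarities
cannot accumulate. The system of which `S'` is a deformation plays no role. -/
theorem theorem20 {n n' m : ℕ} (P : Polygon ℂ n) (P' : Polygon ℂ n')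
    (S S' : Fin m → PolygonalSystem.ContractingSimilarity) (δ : ℝ) (hδ : 0 < δ)
    (hS : PolygonalSystem.IsContractiblePolygonalSystem P S)
    (hS' : PolygonalSystem.IsGeneralizedPolygonalSystem P' S')
    (hdef : PolygonalSystem.IsDeformation δ P S P' S')
    (K' : Set ℂ) (hK' : PolygonalSystem.IsAttractor S' K')
    (hdend : PolygonalSystem.IsDendrite K') :
    PolygonalSystem.ParameterMatchingCondition P' S' K' := by
  refine ⟨fun A hA => ?_, fun B _ A A' _ _ i j _ _ hi hj lam lam' h h' =>
    h.eq_of_wordMap_eq hK' hdend.2.2.2 h' (hi.trans hj.symm)⟩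
  obtain ⟨-, w, hw, hwA⟩ := hA
  obtain ⟨x, hx, hxA⟩ := hS'.exists_ne hK' A
  obtain ⟨lam, hlam⟩ := hK'.exists_isParameter hdend.2.1 hw hwA hx hxA
  exact ⟨lam, hlam, fun lam' h' =>
    h'.eq_of_wordMap_eq hK' hdend.2.2.2 hlam (u := []) (u' := []) rfl⟩
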